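/- Let $P_{LCORR}(n)=P_{LCORR}(n,k)=\mathsf{conv}\{bb^T : b\in\{0,1\}^n,\ \sum_{i=1}^n b_i\le k\}\subseteq\mathbb{R}^{n\times n}$, let $\sigma P=\{\sigma x : x\in P\}$, and let the extension complexity $\mathsf{xc}(K)$ of a polytope $K$ be the minimal number of facets of a polytope $Q\subseteq\mathbb{R}^{d}$ ($d$ arbitrary) (polytopes are convex hulls of finite sets) that some linear map sends onto $K$. There is an absolute constant $0<\alpha<1$ such that the following holds for all integers $n,k\ge 1$ and all real $\sigma$ with $$1\le\sigma^8\le\frac{1}{3\cdot 1000^8}\log_2\left(\frac{n}{k}\right):$$ for every polytope $K$ with $P_{LCORR}(n)\subseteq K\subseteq\sigma P_{LCORR}(n)$, $$\mathsf{xc}(K)\ge\binom{n}{\lceil\alpha k/\sigma^8\rceil}.$$ -/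

import Mathlib

open scoped Pointwise

/-- A polytope: the convex hull of a finite set of points of a real vector space. -/
def IsPolytope {E : Type*} [AddCommGroup E] [Module ℝ E] (P : Set E) : Prop :=
  ∃ V : Set E, V.Finite ∧ P = convexHull ℝ V

/-- `F` is a facet of `P`: a nonempty (exposed) face whose dimension is one less than that of `P`.
The dimension of a nonempty set is the dimension of the direction of its affine hull. -/
def IsFacet {E : Type*} [AddCommGroup E] [Module ℝ E] [TopologicalSpace E]
    (P F : Set E) : Prop :=
  F.Nonempty ∧ IsExposed ℝ P F ∧
    Module.finrank ℝ (vectorSpan ℝ F) + 1 = Module.finrank ℝ (vectorSpan ℝ P)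

/-- The number of facets of `P`. -/
noncomputable def numFacets {E : Type*} [AddCommGroup E] [Module ℝ E] [TopologicalSpace E]
    (P : Set E) : ℕ∞ :=
  {F : Set E | IsFacet P F}.encard

/-- The polytope `Q ⊆ ℝ^d` is an extended formulation of `P`: some linear map sends `Q` onto `P`. -/
def IsExtendedFormulation {E : Type*} [AddCommGroup E] [Module ℝ E] {d : ℕ}
    (Q : Set (Fin d → ℝ)) (P : Set E) : Prop :=
  IsPolytope Q ∧ ∃ π : (Fin d → ℝ) →ₗ[ℝ] E, π '' Q = P

/-- The extension complexity of `P`: the minimal number of facets of an extended formulation. -/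
noncomputable def extensionComplexity {E : Type*} [AddCommGroup E] [Module ℝ E]
    (P : Set E) : ℕ∞ :=
  ⨅ (d : ℕ) (Q : Set (Fin d → ℝ)) (_ : IsExtendedFormulation Q P), numFacets Q

/-- The lopsided correlation polytope: the convex hull of the matrices `b bᵀ` over the
0/1 vectors `b` of length `n` with at most `k` ones. -/
def lcorrPolytope (n k : ℕ) : Set (Matrix (Fin n) (Fin n) ℝ) :=
  convexHull ℝ {M | ∃ b : Fin n → ℝ, (∀ i, b i = 0 ∨ b i = 1) ∧ ∑ i, b i ≤ k ∧
    M = Matrix.vecMulVec b b}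

/-! A polytope `Q` with finitely many facets that projects onto `K` factors every slack matrix of
`K` (affine functions nonnegative on `K`, evaluated at points of `K`) into nonnegative terms, one
per facet (`exists_facet_factorization`). The relevant points are the matrices bbᵀ and the functions
are `disjFunctional a` plus σ, which are nonnegative on σP. The slack is σ - 1 + (1 - ⟨a, b⟩)²: it
equals σ on disjoint pairs and σ - 1 on pairs that meet in one point. It remains to show that this
matrix has no short nonnegative factorization.

The engine is `Coupling.EntropyBound`. For one term a(x)b(y), its mass under l times a law on
disjoint pairs, minus its mass under a form κ of total mass l, is paid for by two entropy gains.
Summed over the r terms of a normalized factorization, each gain is at most s log(r/s), with s the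
normalized value on disjoint pairs (`EntropyBound.le_log_card`). On the other side at least l/2
remains before normalization, because half of κ sees σ - 1 instead of σ. So l is at most a multiple
of σ log r, up to the cost of normalizing.

Two operations produce large l. Doubling (`EntropyBound.double`) hides x behind one of two
independent samples; a cut-and-paste argument raises l by one, so sets of size 2^L give l = L.
Products (`EntropyBound.prod`) add the bounds by the chain rule, so k blocks of size 2^(L+1) give l
= kL with L close to log₂(n/k). The resulting bound on log r exceeds the logarithm of the binomial
coefficient. When the lower index is 1 the coefficient is n, and a rank argument suffices. -/

/-! ### Entropy and Hellinger inequalities for real numbers -/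

-- Squared Hellinger distance is at most generalized relative entropy: this is log z ≤ z - 1 at z =
-- √q / √p, multiplied by `p`.
open Real in
theorem sq_sqrt_sub_sqrt_le_mul_log {p q : ℝ} (hp : 0 ≤ p) (hq : 0 < q) :
    (√p - √q) ^ 2 ≤ -negMulLog p - p * log q - p + q := by
  rcases hp.eq_or_lt with rfl | hp
  · simp [Real.sq_sqrt hq.le]
  · have h1 : log (√q / √p) ≤ √q / √p - 1 := log_le_sub_one_of_pos (by positivity)
    rw [log_div (by positivity) (by positivity), log_sqrt hq.le, log_sqrt hp.le] at h1
    have h2 : p * (√q / √p) = √p * √q := by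
      have : √p ≠ 0 := by positivity
      field_simp
      rw [Real.sq_sqrt hp.le]
    have h3 := mul_le_mul_of_nonneg_left h1 hp.le
    have h4 : (√p - √q) ^ 2 = p - 2 * (√p * √q) + q := by
      rw [sub_sq, Real.sq_sqrt hp.le, Real.sq_sqrt hq.le]; ring
    rw [h4, negMulLog]
    nlinarith

-- The Jensen gap of `negMulLog` is the average relative entropy to the mean, so the previous bound
-- applies termwise.
open Real in
theorem sum_mul_sq_sqrt_sub_le {ι : Type*} [Fintype ι] (w f : ι → ℝ) (hw : ∀ i, 0 ≤ w i)
    (hw1 : ∑ i, w i = 1) (hf : ∀ i, 0 ≤ f i) :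
    ∑ i, w i * (√(f i) - √(∑ j, w j * f j)) ^ 2 ≤
      negMulLog (∑ j, w j * f j) - ∑ i, w i * negMulLog (f i) := by
  set M := ∑ j, w j * f j with hM
  have hM0 : 0 ≤ M := Finset.sum_nonneg fun i _ => mul_nonneg (hw i) (hf i)
  rcases hM0.eq_or_lt with h | h
  · have hz : ∀ i, w i * f i = 0 := by
      have := (Finset.sum_eq_zero_iff_of_nonneg
        (fun i (_ : i ∈ Finset.univ) => mul_nonneg (hw i) (hf i))).1 h.symm
      exact fun i => this i (Finset.mem_univ i)
    rw [← h]
    have h1 : ∀ i, w i * √(f i) ^ 2 = 0 := fun i => by rw [Real.sq_sqrt (hf i), hz i]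
    have h2 : ∀ i, w i * negMulLog (f i) = 0 := fun i => by
      rw [negMulLog, show w i * (-f i * log (f i)) = - (w i * f i) * log (f i) by ring, hz i]
      simp
    simp [h1, h2]
  · have key : ∀ i, w i * (√(f i) - √M) ^ 2 ≤
        -(w i * negMulLog (f i)) - (w i * f i) * log M - w i * f i + w i * M := fun i => by
      have := mul_le_mul_of_nonneg_left (sq_sqrt_sub_sqrt_le_mul_log (hf i) h) (hw i)
      linarith
    refine (Finset.sum_le_sum fun i _ => key i).trans (le_of_eq ?_)
    simp only [Finset.sum_add_distrib, Finset.sum_sub_distrib, Finset.sum_neg_distrib,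
      ← Finset.sum_mul, hw1, ← hM]
    rw [negMulLog]; ring

-- The two-point Jensen gap controls the distances of √a and √b to the root of the mean; the
-- triangle inequality for squares costs the factor 4.
open Real in
theorem quarter_sq_sqrt_sub_le {a b : ℝ} (ha : 0 ≤ a) (hb : 0 ≤ b) :
    (√a - √b) ^ 2 / 4 ≤ negMulLog ((a + b) / 2) - (negMulLog a + negMulLog b) / 2 := by
  have := sum_mul_sq_sqrt_sub_le (fun _ : Fin 2 => (1 / 2 : ℝ)) ![a, b] (by intro; norm_num)
    (by simp) (by intro i; fin_cases i <;> simpa)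
  simp only [Fin.sum_univ_two, Matrix.cons_val_zero, Matrix.cons_val_one] at this
  have h : 1 / 2 * a + 1 / 2 * b = (a + b) / 2 := by ring
  rw [h] at this
  nlinarith [sq_nonneg ((√a - √((a + b) / 2)) + (√b - √((a + b) / 2)))]

/-- When `b`, `β` and `A₁`, `A₂` are Hellinger-close, partners can be exchanged between products.
With p, q, s, t the roots of `A₁`, `A₂`, `b`, `β`, the right side minus the left side is (ps - qt)²
+ (p(s - t) - s(q - p))². -/
theorem cut_and_paste {A₁ A₂ b β : ℝ} (h₁ : 0 ≤ A₁) (h₂ : 0 ≤ A₂) (hb : 0 ≤ b) (hβ : 0 ≤ β) :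
    A₁ * β + A₂ * b - A₁ * b - 2 * (A₁ * (√b - √β) ^ 2) - 2 * (b * (√A₁ - √A₂) ^ 2) ≤
      A₂ * β := by
  obtain ⟨p, hp, rfl⟩ : ∃ p, 0 ≤ p ∧ A₁ = p ^ 2 := ⟨√A₁, by positivity, (Real.sq_sqrt h₁).symm⟩
  obtain ⟨q, hq, rfl⟩ : ∃ p, 0 ≤ p ∧ A₂ = p ^ 2 := ⟨√A₂, by positivity, (Real.sq_sqrt h₂).symm⟩
  obtain ⟨s, hs, rfl⟩ : ∃ p, 0 ≤ p ∧ b = p ^ 2 := ⟨√b, by positivity, (Real.sq_sqrt hb).symm⟩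
  obtain ⟨t, ht, rfl⟩ : ∃ p, 0 ≤ p ∧ β = p ^ 2 := ⟨√β, by positivity, (Real.sq_sqrt hβ).symm⟩
  rw [Real.sqrt_sq hp, Real.sqrt_sq hq, Real.sqrt_sq hs, Real.sqrt_sq ht]
  nlinarith [sq_nonneg (p * s - q * t), sq_nonneg (p * (s - t) + s * (q - p)),
    sq_nonneg (p * (s - t) - s * (q - p)), sq_nonneg (p * (s - t) + s * (p - q))]

/-- Entropy is largest at the uniform weight: sum the tangent bound of `negMulLog` there. -/
theorem sum_negMulLog_le {ι : Type*} [Fintype ι] (p : ι → ℝ) (hp : ∀ i, 0 ≤ p i) {s : ℝ}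
    (hs : 0 < s) (hsum : ∑ i, p i = s) :
    ∑ i, Real.negMulLog (p i) ≤ s * Real.log (Fintype.card ι / s) := by
  have hne : Nonempty ι := by
    by_contra h
    rw [not_nonempty_iff] at h
    simp at hsum
    exact hs.ne hsum
  have hr : (0 : ℝ) < Fintype.card ι := by exact_mod_cast Fintype.card_pos
  set t := s / Fintype.card ι with ht
  have ht0 : 0 < t := by positivity
  have key : ∀ i, Real.negMulLog (p i) ≤ t - p i - p i * Real.log t := fun i => by
    have := (sq_nonneg _).trans (sq_sqrt_sub_sqrt_le_mul_log (hp i) ht0)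
    linarith
  refine (Finset.sum_le_sum fun i _ => key i).trans (le_of_eq ?_)
  simp only [Finset.sum_sub_distrib, ← Finset.sum_mul, hsum, Finset.sum_const, Finset.card_univ,
    nsmul_eq_mul]
  rw [ht, Real.log_div hs.ne' hr.ne', Real.log_div hr.ne' hs.ne']
  field_simp
  ring

/-! ### Couplings, entropy gains and the doubling step -/

/-- A reversible pair of Markov kernels between two finite weighted sets; equivalently a coupling
of the two probability weights `ρ` and `τ`. -/
structure Coupling (X Y : Type*) [Fintype X] [Fintype Y] where
  ρ : X → ℝ
  τ : Y → ℝ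
  down : Y → X → ℝ
  up : X → Y → ℝ
  ρ_nonneg : ∀ x, 0 ≤ ρ x
  τ_nonneg : ∀ y, 0 ≤ τ y
  down_nonneg : ∀ y x, 0 ≤ down y x
  up_nonneg : ∀ x y, 0 ≤ up x y
  sum_ρ : ∑ x, ρ x = 1
  sum_τ : ∑ y, τ y = 1
  sum_down : ∀ y, ∑ x, down y x = 1
  sum_up : ∀ x, ∑ y, up x y = 1
  rev : ∀ x y, ρ x * up x y = τ y * down y x

namespace Coupling

open Real

variable {X Y X' Y' : Type*} [Fintype X] [Fintype Y] [Fintype X'] [Fintype Y']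

/-- The joint probability of a pair. -/
def joint (C : Coupling X Y) (x : X) (y : Y) : ℝ := C.ρ x * C.up x y

theorem joint_eq (C : Coupling X Y) (x : X) (y : Y) : C.joint x y = C.τ y * C.down y x :=
  C.rev x y

theorem joint_nonneg (C : Coupling X Y) (x : X) (y : Y) : 0 ≤ C.joint x y :=
  mul_nonneg (C.ρ_nonneg x) (C.up_nonneg x y)

/-- Conditional expectation given the second component. -/
def avgDown (C : Coupling X Y) (a : X → ℝ) (y : Y) : ℝ := ∑ x, C.down y x * a x

/-- Conditional expectation given the first component. -/
def avgUp (C : Coupling X Y) (b : Y → ℝ) (x : X) : ℝ := ∑ y, C.up x y * b y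

theorem avgDown_nonneg (C : Coupling X Y) {a : X → ℝ} (ha : ∀ x, 0 ≤ a x) (y : Y) :
    0 ≤ C.avgDown a y := Finset.sum_nonneg fun x _ => mul_nonneg (C.down_nonneg y x) (ha x)

theorem avgUp_nonneg (C : Coupling X Y) {b : Y → ℝ} (hb : ∀ y, 0 ≤ b y) (x : X) :
    0 ≤ C.avgUp b x := Finset.sum_nonneg fun y _ => mul_nonneg (C.up_nonneg x y) (hb y)

/-- Reversibility makes the two averaging operators adjoint. -/
theorem sum_ρ_mul_avgUp (C : Coupling X Y) (a : X → ℝ) (b : Y → ℝ) :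
    ∑ x, C.ρ x * (a x * C.avgUp b x) = ∑ y, C.τ y * (C.avgDown a y * b y) := by
  simp only [avgUp, avgDown, Finset.mul_sum, Finset.sum_mul]
  rw [Finset.sum_comm]
  refine Finset.sum_congr rfl fun y _ => Finset.sum_congr rfl fun x _ => ?_
  linear_combination (a x * b y) * C.rev x y

theorem sum_joint (C : Coupling X Y) (a : X → ℝ) (b : Y → ℝ) :
    ∑ x, ∑ y, C.joint x y * (a x * b y) = ∑ y, C.τ y * (C.avgDown a y * b y) := by
  rw [← sum_ρ_mul_avgUp]
  simp only [avgUp, Finset.mul_sum, joint]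
  exact Finset.sum_congr rfl fun x _ => Finset.sum_congr rfl fun y _ => by ring

theorem sum_τ_mul_avgDown (C : Coupling X Y) (a : X → ℝ) :
    ∑ y, C.τ y * C.avgDown a y = ∑ x, C.ρ x * a x := by
  have := C.sum_ρ_mul_avgUp a (fun _ => 1)
  simpa [avgUp, C.sum_up] using this.symm

/-- The entropy of `b` relative to its conditional expectation, in the law tilted by `a`. -/
noncomputable def upGain (C : Coupling X Y) (a : X → ℝ) (b : Y → ℝ) : ℝ :=
  ∑ x, C.ρ x * (a x * negMulLog (C.avgUp b x)) - ∑ y, C.τ y * (C.avgDown a y * negMulLog (b y))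

/-- The entropy of `a` relative to its conditional expectation, in the law tilted by `b`. -/
noncomputable def downGain (C : Coupling X Y) (a : X → ℝ) (b : Y → ℝ) : ℝ :=
  ∑ y, C.τ y * (b y * negMulLog (C.avgDown a y)) -
    ∑ y, C.τ y * (b y * C.avgDown (fun x => negMulLog (a x)) y)

/-- The entropy inequality: the excess of `l` times the coupling over the form `κ` is bounded by
the entropies of both factors. -/
def EntropyBound (C : Coupling X Y) (l : ℝ) (κ : X → Y → ℝ) : Prop :=
  ∀ (a : X → ℝ) (b : Y → ℝ), (∀ x, 0 ≤ a x) → (∀ y, 0 ≤ b y) →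
    l * ∑ x, ∑ y, C.joint x y * (a x * b y) - ∑ x, ∑ y, κ x y * (a x * b y) ≤
      2 * C.upGain a b + 8 * C.downGain a b

/-- The second component is replaced by a pair of independent samples, one of which (chosen at
random) is coupled to the first component. -/
noncomputable def double (C : Coupling X Y) : Coupling X (Y × Y) where
  ρ := C.ρ
  τ y := C.τ y.1 * C.τ y.2
  down y x := (C.down y.1 x + C.down y.2 x) / 2
  up x y := (C.up x y.1 * C.τ y.2 + C.τ y.1 * C.up x y.2) / 2
  ρ_nonneg := C.ρ_nonneg
  τ_nonneg y := mul_nonneg (C.τ_nonneg _) (C.τ_nonneg _)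
  down_nonneg y x := div_nonneg (add_nonneg (C.down_nonneg _ _) (C.down_nonneg _ _)) two_pos.le
  up_nonneg x y := div_nonneg (add_nonneg (mul_nonneg (C.up_nonneg _ _) (C.τ_nonneg _))
    (mul_nonneg (C.τ_nonneg _) (C.up_nonneg _ _))) two_pos.le
  sum_ρ := C.sum_ρ
  sum_τ := by
    rw [Fintype.sum_prod_type]
    simp [← Finset.mul_sum, C.sum_τ]
  sum_down y := by
    rw [← Finset.sum_div, Finset.sum_add_distrib, C.sum_down, C.sum_down]; norm_num
  sum_up x := by
    rw [← Finset.sum_div, Finset.sum_add_distrib, Fintype.sum_prod_type, Fintype.sum_prod_type]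
    simp [← Finset.mul_sum, C.sum_τ, C.sum_up]
  rev x y := by linear_combination (C.τ y.2 / 2) * C.rev x y.1 + (C.τ y.1 / 2) * C.rev x y.2

/-- The gains of the pair exceed the mean of the gains for `b₁` and `b₂` by Jensen gaps, which
dominate Hellinger distances. By cut-and-paste these distances bound the coupled expectation minus
the independent value `S * T`, which is the extra unit of `l`. The coefficient 2 comes from the gaps
of `b`, and 8 = 2 · 4 from the gaps of `A`. -/
theorem EntropyBound.double {C : Coupling X Y} {l : ℝ}
    (h : C.EntropyBound l fun x y => l * (C.ρ x * C.τ y)) :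
    C.double.EntropyBound (l + 1) fun x y => (l + 1) * (C.double.ρ x * C.double.τ y) := by
  intro a b ha hb
  set A := C.avgDown a with hA
  set N := C.avgDown fun x => negMulLog (a x) with hN
  set b₁ : Y → ℝ := fun y₁ => ∑ y₂, C.τ y₂ * b (y₁, y₂) with hb₁
  set b₂ : Y → ℝ := fun y₂ => ∑ y₁, C.τ y₁ * b (y₁, y₂) with hb₂
  have hA0 : ∀ y, 0 ≤ A y := C.avgDown_nonneg ha
  have hb₁0 : ∀ y, 0 ≤ b₁ y := fun y => Finset.sum_nonneg fun i _ => mul_nonneg (C.τ_nonneg _) (hb _)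
  have hb₂0 : ∀ y, 0 ≤ b₂ y := fun y => Finset.sum_nonneg fun i _ => mul_nonneg (C.τ_nonneg _) (hb _)
  -- expectation over the pair of samples
  set E : (Y → Y → ℝ) → ℝ := fun f => ∑ y₁, ∑ y₂, C.τ y₁ * C.τ y₂ * f y₁ y₂ with hE
  have E_add : ∀ f g, E (fun y z => f y z + g y z) = E f + E g := fun f g => by
    simp only [hE, mul_add, Finset.sum_add_distrib]
  have E_sub : ∀ f g, E (fun y z => f y z - g y z) = E f - E g := fun f g => by
    simp only [hE, mul_sub, Finset.sum_sub_distrib]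
  have E_smul : ∀ (c : ℝ) f, E (fun y z => c * f y z) = c * E f := fun c f => by
    simp only [hE, Finset.mul_sum]
    exact Finset.sum_congr rfl fun _ _ => Finset.sum_congr rfl fun _ _ => by ring
  have E_mono : ∀ f g : Y → Y → ℝ, (∀ y z, f y z ≤ g y z) → E f ≤ E g := fun f g hfg =>
    Finset.sum_le_sum fun y _ => Finset.sum_le_sum fun z _ =>
      mul_le_mul_of_nonneg_left (hfg y z) (mul_nonneg (C.τ_nonneg _) (C.τ_nonneg _))
  have E_left : ∀ (f : Y → ℝ) (g : Y → Y → ℝ),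
      E (fun y z => f y * g y z) = ∑ y, C.τ y * (f y * ∑ z, C.τ z * g y z) := fun f g => by
    simp only [hE, Finset.mul_sum]
    exact Finset.sum_congr rfl fun _ _ => Finset.sum_congr rfl fun _ _ => by ring
  have E_right : ∀ (f : Y → ℝ) (g : Y → Y → ℝ),
      E (fun y z => f z * g y z) = ∑ z, C.τ z * (f z * ∑ y, C.τ y * g y z) := fun f g => by
    simp only [hE, Finset.mul_sum]
    rw [Finset.sum_comm]
    exact Finset.sum_congr rfl fun _ _ => Finset.sum_congr rfl fun _ _ => by ring
  have dA : ∀ y, C.double.avgDown a y = (A y.1 + A y.2) / 2 := fun y => by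
    simp only [avgDown, Coupling.double, hA, ← Finset.sum_add_distrib, Finset.sum_div]
    exact Finset.sum_congr rfl fun _ _ => by ring
  have dN : ∀ y, C.double.avgDown (fun x => negMulLog (a x)) y = (N y.1 + N y.2) / 2 := fun y => by
    simp only [avgDown, Coupling.double, hN, ← Finset.sum_add_distrib, Finset.sum_div]
    exact Finset.sum_congr rfl fun _ _ => by ring
  have dB : ∀ x, C.double.avgUp b x = (C.avgUp b₁ x + C.avgUp b₂ x) / 2 := fun x => by
    simp only [avgUp, Coupling.double, hb₁, hb₂, Fintype.sum_prod_type, Finset.mul_sum]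
    rw [Finset.sum_comm (f := fun y₂ y₁ => C.up x y₂ * (C.τ y₁ * b (y₁, y₂)))]
    simp only [← Finset.sum_add_distrib, Finset.sum_div]
    exact Finset.sum_congr rfl fun _ _ => Finset.sum_congr rfl fun _ _ => by ring
  have toE : ∀ f : Y → Y → ℝ, ∑ y : Y × Y, C.double.τ y * f y.1 y.2 = E f := fun f => by
    rw [Fintype.sum_prod_type]; rfl
  set S := ∑ x, C.ρ x * a x with hS
  have hSA : ∑ y, C.τ y * A y = S := C.sum_τ_mul_avgDown a
  set T := E fun y z => b (y, z) with hT
  have hT₁ : ∑ y, C.τ y * b₁ y = T := by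
    simpa using (E_left (fun _ => 1) fun y z => b (y, z)).symm
  have hT₂ : ∑ y, C.τ y * b₂ y = T := by
    simpa using (E_right (fun _ => 1) fun y z => b (y, z)).symm
  have prod_form : ∀ {Z : Type _} [Fintype Z] (c : ℝ) (t β : Z → ℝ),
      ∑ x, ∑ z, c * (C.ρ x * t z) * (a x * β z) = c * (S * ∑ z, t z * β z) := by
    intro Z _ c t β
    simp only [hS, Finset.mul_sum, Finset.sum_mul]
    rw [Finset.sum_comm]
    exact Finset.sum_congr rfl fun _ _ => Finset.sum_congr rfl fun _ _ => by ring
  have IH₁ := h a b₁ ha hb₁0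
  have IH₂ := h a b₂ ha hb₂0
  simp only [C.sum_joint, upGain, downGain, ← hA, ← hN] at IH₁ IH₂
  rw [prod_form l C.τ b₁, hT₁] at IH₁
  rw [prod_form l C.τ b₂, hT₂] at IH₂
  simp only [C.double.sum_joint, upGain, downGain, dA, dN, dB]
  rw [show (∑ x, ∑ y : Y × Y, (l + 1) * (C.double.ρ x * C.double.τ y) * (a x * b y)) =
    (l + 1) * (S * T) from (prod_form (l + 1) C.double.τ b).trans
      (by rw [show ∑ z, C.double.τ z * b z = T from toE fun y z => b (y, z)])]
  rw [toE fun y z => (A y + A z) / 2 * b (y, z),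
    toE fun y z => (A y + A z) / 2 * negMulLog (b (y, z)),
    toE fun y z => b (y, z) * negMulLog ((A y + A z) / 2),
    toE fun y z => b (y, z) * ((N y + N z) / 2)]
  -- Plain concavity suffices on this side; the Hellinger surplus is dropped.
  have hup : ∑ x, C.double.ρ x * (a x * negMulLog ((C.avgUp b₁ x + C.avgUp b₂ x) / 2)) ≥
      (∑ x, C.ρ x * (a x * negMulLog (C.avgUp b₁ x)) +
        ∑ x, C.ρ x * (a x * negMulLog (C.avgUp b₂ x))) / 2 := by
    rw [← Finset.sum_add_distrib, Finset.sum_div]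
    refine Finset.sum_le_sum fun x _ => ?_
    have h1 := quarter_sq_sqrt_sub_le (C.avgUp_nonneg hb₁0 x) (C.avgUp_nonneg hb₂0 x)
    have h2 := mul_nonneg (C.ρ_nonneg x) (ha x)
    have h3 : (negMulLog (C.avgUp b₁ x) + negMulLog (C.avgUp b₂ x)) / 2 ≤
      negMulLog ((C.avgUp b₁ x + C.avgUp b₂ x) / 2) := by
      linarith [div_nonneg (sq_nonneg (√(C.avgUp b₁ x) - √(C.avgUp b₂ x))) (zero_le_four (α := ℝ))]
    have h4 := mul_le_mul_of_nonneg_left h3 h2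
    change _ ≤ C.ρ x * _
    linarith
  have half : ∀ (f : Y → ℝ) (g : Y → Y → ℝ), E (fun y z => (f y + f z) / 2 * g y z) =
      (E (fun y z => f y * g y z) + E (fun y z => f z * g y z)) / 2 := fun f g => by
    rw [← E_add, div_eq_inv_mul, ← E_smul]
    congr 1; funext y z; ring
  have hNE : E (fun y z => b (y, z) * ((N y + N z) / 2)) =
      (∑ y, C.τ y * (b₁ y * N y) + ∑ y, C.τ y * (b₂ y * N y)) / 2 := by
    rw [show (fun y z => b (y, z) * ((N y + N z) / 2)) = fun y z => (N y + N z) / 2 * b (y, z) by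
      funext y z; ring, half, E_left, E_right]
    simp only [hb₁, hb₂, mul_comm]
  have hJ : E (fun y z => (A y + A z) / 2 * b (y, z)) =
      (∑ y, C.τ y * (A y * b₁ y) + ∑ y, C.τ y * (A y * b₂ y)) / 2 := by
    rw [half, E_left, E_right]
  have hηA : E (fun y z => b (y, z) * ((negMulLog (A y) + negMulLog (A z)) / 2)) =
      (∑ y, C.τ y * (b₁ y * negMulLog (A y)) + ∑ y, C.τ y * (b₂ y * negMulLog (A y))) / 2 := by
    rw [show (fun y z => b (y, z) * ((negMulLog (A y) + negMulLog (A z)) / 2)) =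
      fun y z => (negMulLog (A y) + negMulLog (A z)) / 2 * b (y, z) by
        funext y z; ring, half (fun y => negMulLog (A y)), E_left (fun y => negMulLog (A y)),
        E_right (fun y => negMulLog (A y))]
    simp only [hb₁, hb₂, mul_comm]
  have hsq₁ : E (fun y z => A y * (√(b (y, z)) - √(b₁ y)) ^ 2) ≤
      ∑ y, C.τ y * (A y * negMulLog (b₁ y)) - E (fun y z => A y * negMulLog (b (y, z))) := by
    rw [E_left, E_left, ← Finset.sum_sub_distrib]
    refine Finset.sum_le_sum fun y _ => ?_
    have := mul_le_mul_of_nonneg_left (sum_mul_sq_sqrt_sub_le C.τ (fun z => b (y, z)) C.τ_nonneg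
      C.sum_τ fun z => hb _) (mul_nonneg (C.τ_nonneg y) (hA0 y))
    linarith
  have hsq₂ : E (fun y z => A z * (√(b (y, z)) - √(b₂ z)) ^ 2) ≤
      ∑ y, C.τ y * (A y * negMulLog (b₂ y)) - E (fun y z => A z * negMulLog (b (y, z))) := by
    rw [E_right, E_right, ← Finset.sum_sub_distrib]
    refine Finset.sum_le_sum fun z _ => ?_
    have := mul_le_mul_of_nonneg_left (sum_mul_sq_sqrt_sub_le C.τ (fun y => b (y, z)) C.τ_nonneg
      C.sum_τ fun y => hb _) (mul_nonneg (C.τ_nonneg z) (hA0 z))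
    linarith
  have hsqA : E (fun y z => b (y, z) * (√(A y) - √(A z)) ^ 2) ≤
      4 * (E (fun y z => b (y, z) * negMulLog ((A y + A z) / 2)) -
        E (fun y z => b (y, z) * ((negMulLog (A y) + negMulLog (A z)) / 2))) := by
    rw [← E_sub, ← E_smul]
    refine E_mono _ _ fun y z => ?_
    have := mul_le_mul_of_nonneg_left (quarter_sq_sqrt_sub_le (hA0 y) (hA0 z)) (hb (y, z))
    linarith
  have hST₁ : E (fun y z => A z * b₁ y) = S * T := by
    rw [E_right, hT₁, ← hSA, Finset.sum_mul]
    exact Finset.sum_congr rfl fun _ _ => by ring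
  have hST₂ : E (fun y z => A y * b₂ z) = S * T := by
    rw [E_left, hT₂, ← hSA, Finset.sum_mul]
    exact Finset.sum_congr rfl fun _ _ => by ring
  -- The two samples are independent, so after the exchange `A z * b₁ y` and `A y * b₂ z` both
  -- average to `S * T`.
  have cp₁ := E_mono _ _ fun y z => cut_and_paste (hA0 y) (hA0 z) (hb (y, z)) (hb₁0 y)
  have cp₂ := E_mono _ _ fun y z => cut_and_paste (hA0 z) (hA0 y) (hb (y, z)) (hb₂0 z)
  have hd₁ : E (fun y z => A y * b₁ y) = E fun y z => A y * b (y, z) := by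
    rw [E_left, E_left]; simp [← Finset.sum_mul, C.sum_τ, hb₁]
  have hd₂ : E (fun y z => A z * b₂ z) = E fun y z => A z * b (y, z) := by
    rw [E_right, E_right]; simp [← Finset.sum_mul, C.sum_τ, hb₂]
  have hswap : E (fun y z => b (y, z) * (√(A z) - √(A y)) ^ 2) =
      E fun y z => b (y, z) * (√(A y) - √(A z)) ^ 2 := by
    congr 1; funext y z; ring
  rw [E_sub, E_sub, E_sub, E_add, E_smul, E_smul] at cp₁ cp₂
  rw [hST₁, hd₁] at cp₁
  rw [hST₂, hd₂, hswap] at cp₂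
  have hhalfη := half A fun y z => negMulLog (b (y, z))
  have hJ' := half A fun y z => b (y, z)
  rw [hNE, hhalfη]
  rw [hηA] at hsqA
  have key : l * E (fun y z => (A y + A z) / 2 * b (y, z)) =
      (l * ∑ y, C.τ y * (A y * b₁ y) + l * ∑ y, C.τ y * (A y * b₂ y)) / 2 := by
    rw [hJ]; ring
  linarith

end Coupling

/-! ### Tensorization and the bound on the number of terms -/

namespace Coupling

open Real

variable {X Y X' Y' : Type*} [Fintype X] [Fintype Y] [Fintype X'] [Fintype Y']

/-- The product of two independent couplings. -/
def prod (C : Coupling X Y) (D : Coupling X' Y') : Coupling (X × X') (Y × Y') where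
  ρ x := C.ρ x.1 * D.ρ x.2
  τ y := C.τ y.1 * D.τ y.2
  down y x := C.down y.1 x.1 * D.down y.2 x.2
  up x y := C.up x.1 y.1 * D.up x.2 y.2
  ρ_nonneg x := mul_nonneg (C.ρ_nonneg _) (D.ρ_nonneg _)
  τ_nonneg y := mul_nonneg (C.τ_nonneg _) (D.τ_nonneg _)
  down_nonneg y x := mul_nonneg (C.down_nonneg _ _) (D.down_nonneg _ _)
  up_nonneg x y := mul_nonneg (C.up_nonneg _ _) (D.up_nonneg _ _)
  sum_ρ := by rw [Fintype.sum_prod_type]; simp [← Finset.mul_sum, C.sum_ρ, D.sum_ρ]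
  sum_τ := by rw [Fintype.sum_prod_type]; simp [← Finset.mul_sum, C.sum_τ, D.sum_τ]
  sum_down y := by rw [Fintype.sum_prod_type]; simp [← Finset.mul_sum, C.sum_down, D.sum_down]
  sum_up x := by rw [Fintype.sum_prod_type]; simp [← Finset.mul_sum, C.sum_up, D.sum_up]
  rev x y := by
    linear_combination (D.ρ x.2 * D.up x.2 y.2) * C.rev x.1 y.1 +
      (C.τ y.1 * C.down y.1 x.1) * D.rev x.2 y.2

theorem prod_joint (C : Coupling X Y) (D : Coupling X' Y') (x : X × X') (y : Y × Y') :
    (C.prod D).joint x y = C.joint x.1 y.1 * D.joint x.2 y.2 := by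
  simp only [joint, prod]; ring

/-- Chain rule: the first factor is tested on `a` averaged over x' given y', the second on `b`
averaged over y given x. The intermediate entropies then agree (`e1`, `e5`) and cancel, leaving
exactly the gains of the product. -/
theorem EntropyBound.prod {C : Coupling X Y} {D : Coupling X' Y'} {l l' : ℝ} {κ : X → Y → ℝ}
    {κ' : X' → Y' → ℝ} (hC : C.EntropyBound l κ) (hD : D.EntropyBound l' κ') :
    (C.prod D).EntropyBound (l + l') fun x y =>
      κ x.1 y.1 * D.joint x.2 y.2 + C.joint x.1 y.1 * κ' x.2 y.2 := by
  intro a b ha hb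
  set Aa : X → Y' → ℝ := fun x y' => D.avgDown (fun x' => a (x, x')) y' with hAa
  set Bb : X → Y' → ℝ := fun x y' => C.avgUp (fun y => b (y, y')) x with hBb
  have hAa0 : ∀ x y', 0 ≤ Aa x y' := fun x y' => D.avgDown_nonneg (fun _ => ha _) y'
  have hBb0 : ∀ x y', 0 ≤ Bb x y' := fun x y' => C.avgUp_nonneg (fun _ => hb _) x
  have dA : ∀ (f : X × X' → ℝ) y, (C.prod D).avgDown f y =
      C.avgDown (fun x => D.avgDown (fun x' => f (x, x')) y.2) y.1 := fun f y => by
    simp only [avgDown, Coupling.prod, Fintype.sum_prod_type, Finset.mul_sum]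
    exact Finset.sum_congr rfl fun _ _ => Finset.sum_congr rfl fun _ _ => by ring
  have dB : ∀ x, (C.prod D).avgUp b x = D.avgUp (fun y' => Bb x.1 y') x.2 := fun x => by
    simp only [avgUp, Coupling.prod, hBb, Fintype.sum_prod_type, Finset.mul_sum]
    rw [Finset.sum_comm]
    exact Finset.sum_congr rfl fun _ _ => Finset.sum_congr rfl fun _ _ => by ring
  -- the first factor, averaged over `y'`
  have h1 := Finset.sum_le_sum fun (y' : Y') (_ : y' ∈ Finset.univ) =>
    mul_le_mul_of_nonneg_left (hC (fun x => Aa x y') (fun y => b (y, y')) (fun x => hAa0 x y')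
      fun y => hb _) (D.τ_nonneg y')
  -- the second factor, averaged over `x`
  have h2 := Finset.sum_le_sum fun (x : X) (_ : x ∈ Finset.univ) =>
    mul_le_mul_of_nonneg_left (hD (fun x' => a (x, x')) (fun y' => Bb x y') (fun x' => ha _)
      fun y' => hBb0 x y') (C.ρ_nonneg x)
  have form₁ : ∀ μ : X → Y → ℝ,
      ∑ y', D.τ y' * ∑ x, ∑ y, μ x y * (Aa x y' * b (y, y')) =
        ∑ x : X × X', ∑ y : Y × Y', μ x.1 y.1 * D.joint x.2 y.2 * (a x * b y) := fun μ => by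
    simp only [Fintype.sum_prod_type, Finset.mul_sum, hAa, avgDown, Finset.sum_mul]
    rw [Finset.sum_comm]
    refine Finset.sum_congr rfl fun x _ => ?_
    rw [Finset.sum_comm]
    rw [Finset.sum_comm (s := (Finset.univ : Finset X'))]
    refine Finset.sum_congr rfl fun y _ => ?_
    rw [Finset.sum_comm]
    refine Finset.sum_congr rfl fun x' _ => Finset.sum_congr rfl fun y' _ => ?_
    rw [joint_eq]; ring
  have form₂ : ∀ μ : X' → Y' → ℝ,
      ∑ x, C.ρ x * ∑ x', ∑ y', μ x' y' * (a (x, x') * Bb x y') =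
        ∑ x : X × X', ∑ y : Y × Y', C.joint x.1 y.1 * μ x.2 y.2 * (a x * b y) := fun μ => by
    simp only [Fintype.sum_prod_type, Finset.mul_sum, hBb, avgUp]
    refine Finset.sum_congr rfl fun x _ => Finset.sum_congr rfl fun x' _ => ?_
    rw [Finset.sum_comm]
    refine Finset.sum_congr rfl fun y _ => Finset.sum_congr rfl fun y' _ => ?_
    rw [joint]; ring
  have e1 : ∑ y', D.τ y' * ∑ x, C.ρ x * (Aa x y' * negMulLog (C.avgUp (fun y => b (y, y')) x)) =
      ∑ x, C.ρ x * ∑ y', D.τ y' * (Aa x y' * negMulLog (Bb x y')) := by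
    simp only [Finset.mul_sum]
    rw [Finset.sum_comm]
    exact Finset.sum_congr rfl fun _ _ => Finset.sum_congr rfl fun _ _ => by ring
  have e2 : ∑ y', D.τ y' * ∑ y, C.τ y * (C.avgDown (fun x => Aa x y') y * negMulLog (b (y, y'))) =
      ∑ y, (C.prod D).τ y * ((C.prod D).avgDown a y * negMulLog (b y)) := by
    simp only [Finset.mul_sum, Fintype.sum_prod_type, dA]
    rw [Finset.sum_comm]
    exact Finset.sum_congr rfl fun _ _ => Finset.sum_congr rfl fun _ _ => by
      simp only [Coupling.prod]; ring
  have e3 : ∑ x, C.ρ x * ∑ x', D.ρ x' * (a (x, x') * negMulLog (D.avgUp (fun y' => Bb x y') x')) =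
      ∑ x, (C.prod D).ρ x * (a x * negMulLog ((C.prod D).avgUp b x)) := by
    simp only [Finset.mul_sum, Fintype.sum_prod_type, dB]
    exact Finset.sum_congr rfl fun _ _ => Finset.sum_congr rfl fun _ _ => by
      simp only [Coupling.prod]; ring
  have e4 : ∑ y', D.τ y' * ∑ y, C.τ y * (b (y, y') * negMulLog (C.avgDown (fun x => Aa x y') y)) =
      ∑ y, (C.prod D).τ y * (b y * negMulLog ((C.prod D).avgDown a y)) := by
    simp only [Finset.mul_sum, Fintype.sum_prod_type, dA]
    rw [Finset.sum_comm]
    exact Finset.sum_congr rfl fun _ _ => Finset.sum_congr rfl fun _ _ => by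
      simp only [Coupling.prod]; ring
  have e5 : ∑ y', D.τ y' * ∑ y, C.τ y *
        (b (y, y') * C.avgDown (fun x => negMulLog (Aa x y')) y) =
      ∑ x, C.ρ x * ∑ y', D.τ y' * (Bb x y' * negMulLog (Aa x y')) := by
    have : ∀ y', ∑ y, C.τ y * (b (y, y') * C.avgDown (fun x => negMulLog (Aa x y')) y) =
        ∑ x, C.ρ x * (negMulLog (Aa x y') * Bb x y') := fun y' => by
      rw [hBb, C.sum_ρ_mul_avgUp]
      exact Finset.sum_congr rfl fun _ _ => by ring
    simp only [this, Finset.mul_sum]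
    rw [Finset.sum_comm]
    exact Finset.sum_congr rfl fun _ _ => Finset.sum_congr rfl fun _ _ => by ring
  have e6 : ∑ x, C.ρ x * ∑ y', D.τ y' *
        (Bb x y' * D.avgDown (fun x' => negMulLog (a (x, x'))) y') =
      ∑ y, (C.prod D).τ y * (b y * (C.prod D).avgDown (fun x => negMulLog (a x)) y) := by
    have : ∀ y', ∑ x, C.ρ x * (D.avgDown (fun x' => negMulLog (a (x, x'))) y' * Bb x y') =
        ∑ y, C.τ y * (C.avgDown (fun x => D.avgDown (fun x' => negMulLog (a (x, x'))) y') y *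
          b (y, y')) := fun y' => by
      rw [hBb, C.sum_ρ_mul_avgUp]
    calc _ = ∑ y', D.τ y' *
          ∑ x, C.ρ x * (D.avgDown (fun x' => negMulLog (a (x, x'))) y' * Bb x y') := by
          simp only [Finset.mul_sum]
          rw [Finset.sum_comm]
          exact Finset.sum_congr rfl fun _ _ => Finset.sum_congr rfl fun _ _ => by ring
      _ = _ := by
          simp only [this, dA, Finset.mul_sum, Fintype.sum_prod_type]
          rw [Finset.sum_comm]
          exact Finset.sum_congr rfl fun _ _ => Finset.sum_congr rfl fun _ _ => by
            simp only [Coupling.prod]; ring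
  have fκ : ∑ x : X × X', ∑ y : Y × Y',
      (κ x.1 y.1 * D.joint x.2 y.2 + C.joint x.1 y.1 * κ' x.2 y.2) * (a x * b y) =
      ∑ y', D.τ y' * ∑ x, ∑ y, κ x y * (Aa x y' * b (y, y')) +
        ∑ x, C.ρ x * ∑ x', ∑ y', κ' x' y' * (a (x, x') * Bb x y') := by
    rw [form₁, form₂]
    simp only [← Finset.sum_add_distrib, add_mul]
  have fj : ∑ x, ∑ y, (C.prod D).joint x y * (a x * b y) =
      ∑ x : X × X', ∑ y : Y × Y', C.joint x.1 y.1 * D.joint x.2 y.2 * (a x * b y) := by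
    simp only [prod_joint]
  have fj₁ := (form₁ C.joint).trans fj.symm
  have fj₂ := (form₂ D.joint).trans fj.symm
  beta_reduce
  rw [fκ, upGain, downGain, ← e2, ← e3, ← e4, ← e6]
  simp only [upGain, downGain, mul_add, mul_sub, Finset.sum_add_distrib, Finset.sum_sub_distrib,
    mul_left_comm (D.τ _) l, mul_left_comm (C.ρ _) l', mul_left_comm (D.τ _) (2 : ℝ),
    mul_left_comm (C.ρ _) (2 : ℝ), mul_left_comm (D.τ _) (8 : ℝ), mul_left_comm (C.ρ _) (8 : ℝ),
    ← Finset.mul_sum, e1, e5, fj₁, fj₂] at h1 h2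
  linarith

/-- An entropy bound turns a nonnegative factorization that is constant on the support of the
coupling into a lower bound on the number of terms. -/
theorem EntropyBound.le_log_card {C : Coupling X Y} {l : ℝ} {κ : X → Y → ℝ}
    (hC : C.EntropyBound l κ) {R : Type*} [Fintype R] (u : R → X → ℝ) (v : R → Y → ℝ)
    (hu : ∀ w x, 0 ≤ u w x) (hu1 : ∀ w x, u w x ≤ 1) (hv : ∀ w y, 0 ≤ v w y)
    (hv1 : ∀ w y, v w y ≤ 1) {s : ℝ} (hs : 0 < s)
    (hsum : ∀ x y, C.joint x y ≠ 0 → ∑ w, u w x * v w y = s) :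
    l * s - ∑ x, ∑ y, κ x y * ∑ w, u w x * v w y ≤ 10 * (s * log (Fintype.card R / s)) := by
  have η0 : ∀ {t : ℝ}, 0 ≤ t → t ≤ 1 → 0 ≤ negMulLog t := fun h0 h1 => negMulLog_nonneg h0 h1
  have ηmul : ∀ {t q : ℝ}, 0 ≤ t → t ≤ 1 → 0 ≤ q → t * negMulLog q ≤ negMulLog (t * q) := by
    intro t q ht ht1 hq
    rw [negMulLog_mul]
    have := mul_nonneg hq (η0 ht ht1)
    linarith
  have hj : ∑ x, ∑ y, C.joint x y = 1 := by
    simp [joint, ← Finset.mul_sum, C.sum_up, C.sum_ρ]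
  have hl : ∑ w, ∑ x, ∑ y, C.joint x y * (u w x * v w y) = s := by
    rw [Finset.sum_comm]
    have : ∀ x, ∑ w, ∑ y, C.joint x y * (u w x * v w y) = ∑ y, C.joint x y * s := fun x => by
      rw [Finset.sum_comm]
      refine Finset.sum_congr rfl fun y _ => ?_
      rw [← Finset.mul_sum]
      by_cases h : C.joint x y = 0
      · simp [h]
      · rw [hsum x y h]
    simp only [this, ← Finset.sum_mul, hj, one_mul]
  have hk : ∑ w, ∑ x, ∑ y, κ x y * (u w x * v w y) = ∑ x, ∑ y, κ x y * ∑ w, u w x * v w y := by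
    rw [Finset.sum_comm]
    refine Finset.sum_congr rfl fun x _ => ?_
    rw [Finset.sum_comm]
    simp only [Finset.mul_sum]
  have avgDown_le : ∀ w y, C.avgDown (u w) y ≤ 1 := fun w y => by
    rw [← C.sum_down y]
    exact Finset.sum_le_sum fun x _ => mul_le_of_le_one_right (C.down_nonneg y x) (hu1 w x)
  -- The subtracted entropy is nonnegative because all values lie in [0, 1]. For fixed x the rest is
  -- at most the entropy of weights with total `s`, since the factorization is constant on the
  -- support.
  have hup : ∑ w, C.upGain (u w) (v w) ≤ s * log (Fintype.card R / s) := by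
    have h1 : ∀ w, C.upGain (u w) (v w) ≤
        ∑ x, C.ρ x * (u w x * negMulLog (C.avgUp (v w) x)) := fun w => by
      refine sub_le_self _ (Finset.sum_nonneg fun y _ => ?_)
      exact mul_nonneg (C.τ_nonneg y) (mul_nonneg (C.avgDown_nonneg (hu w) y)
        (η0 (hv w y) (hv1 w y)))
    refine (Finset.sum_le_sum fun w _ => h1 w).trans ?_
    rw [Finset.sum_comm]
    have h2 : ∀ x, ∑ w, C.ρ x * (u w x * negMulLog (C.avgUp (v w) x)) ≤
        C.ρ x * (s * log (Fintype.card R / s)) := fun x => by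
      rw [← Finset.mul_sum]
      by_cases hx : C.ρ x = 0
      · simp [hx]
      refine mul_le_mul_of_nonneg_left ?_ (C.ρ_nonneg x)
      refine (Finset.sum_le_sum fun w _ => ηmul (hu w x) (hu1 w x)
        (C.avgUp_nonneg (hv w) x)).trans ?_
      refine sum_negMulLog_le _ (fun w => mul_nonneg (hu w x) (C.avgUp_nonneg (hv w) x)) hs ?_
      simp only [avgUp, Finset.mul_sum]
      rw [Finset.sum_comm]
      have : ∀ y, ∑ w, u w x * (C.up x y * v w y) = C.up x y * s := fun y => by
        by_cases h : C.up x y = 0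
        · simp [h]
        · rw [← hsum x y (mul_ne_zero hx h), Finset.mul_sum]
          exact Finset.sum_congr rfl fun _ _ => by ring
      simp only [this, ← Finset.sum_mul, C.sum_up, one_mul]
    refine (Finset.sum_le_sum fun x _ => h2 x).trans (le_of_eq ?_)
    rw [← Finset.sum_mul, C.sum_ρ, one_mul]
  have hdown : ∑ w, C.downGain (u w) (v w) ≤ s * log (Fintype.card R / s) := by
    have h1 : ∀ w, C.downGain (u w) (v w) ≤
        ∑ y, C.τ y * (v w y * negMulLog (C.avgDown (u w) y)) := fun w => by
      refine sub_le_self _ (Finset.sum_nonneg fun y _ => ?_)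
      exact mul_nonneg (C.τ_nonneg y) (mul_nonneg (hv w y)
        (C.avgDown_nonneg (fun x => η0 (hu w x) (hu1 w x)) y))
    refine (Finset.sum_le_sum fun w _ => h1 w).trans ?_
    rw [Finset.sum_comm]
    have h2 : ∀ y, ∑ w, C.τ y * (v w y * negMulLog (C.avgDown (u w) y)) ≤
        C.τ y * (s * log (Fintype.card R / s)) := fun y => by
      rw [← Finset.mul_sum]
      by_cases hy : C.τ y = 0
      · simp [hy]
      refine mul_le_mul_of_nonneg_left ?_ (C.τ_nonneg y)
      refine (Finset.sum_le_sum fun w _ => ηmul (hv w y) (hv1 w y)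
        (C.avgDown_nonneg (hu w) y)).trans ?_
      refine sum_negMulLog_le _ (fun w => mul_nonneg (hv w y) (C.avgDown_nonneg (hu w) y)) hs ?_
      simp only [avgDown, Finset.mul_sum]
      rw [Finset.sum_comm]
      have : ∀ x, ∑ w, v w y * (C.down y x * u w x) = C.down y x * s := fun x => by
        by_cases h : C.down y x = 0
        · simp [h]
        · rw [← hsum x y (by rw [joint_eq]; exact mul_ne_zero hy h), Finset.mul_sum]
          exact Finset.sum_congr rfl fun _ _ => by ring
      simp only [this, ← Finset.sum_mul, C.sum_down, one_mul]
    refine (Finset.sum_le_sum fun y _ => h2 y).trans (le_of_eq ?_)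
    rw [← Finset.sum_mul, C.sum_τ, one_mul]
  have main := Finset.sum_le_sum fun (w : R) (_ : w ∈ Finset.univ) =>
    hC (u w) (v w) (hu w) (hv w)
  rw [Finset.sum_sub_distrib, Finset.sum_add_distrib, ← Finset.mul_sum, ← Finset.mul_sum,
    ← Finset.mul_sum, hl, hk] at main
  linarith

end Coupling

/-! ### The hard distribution for lopsided disjointness -/

namespace Coupling

/-- The identical coupling of two copies of a uniform point. -/
noncomputable def diag (m : ℕ) (hm : 0 < m) : Coupling (Fin m) (Fin m) where
  ρ _ := (m : ℝ)⁻¹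
  τ _ := (m : ℝ)⁻¹
  down y x := if y = x then 1 else 0
  up x y := if x = y then 1 else 0
  ρ_nonneg _ := by positivity
  τ_nonneg _ := by positivity
  down_nonneg y x := by split_ifs <;> norm_num
  up_nonneg x y := by split_ifs <;> norm_num
  sum_ρ := by
    have : (m : ℝ) ≠ 0 := by positivity
    simp [this]
  sum_τ := by
    have : (m : ℝ) ≠ 0 := by positivity
    simp [this]
  sum_down y := by simp
  sum_up x := by simp
  rev x y := by simp [eq_comm]

/-- Conditioning on either component determines the other, so both gains vanish. -/
theorem entropyBound_diag (m : ℕ) (hm : 0 < m) :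
    (diag m hm).EntropyBound 0 fun x y => 0 * ((diag m hm).ρ x * (diag m hm).τ y) := by
  intro a b ha hb
  simp [upGain, downGain, diag, avgDown, avgUp]

/-- A uniform point of `Fin m` coupled to a set with at most `2 ^ L` elements containing it. -/
theorem exists_sampling (m L : ℕ) (hm : 0 < m) :
    ∃ (Y : Type) (_ : Fintype Y) (C : Coupling (Fin m) Y) (S : Y → Finset (Fin m)),
      (∀ x, C.ρ x = (m : ℝ)⁻¹) ∧ (∀ y, (S y).card ≤ 2 ^ L) ∧
      (∀ x y, C.down y x ≠ 0 → x ∈ S y) ∧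
      C.EntropyBound L fun x y => L * (C.ρ x * C.τ y) := by
  induction L with
  | zero =>
    refine ⟨Fin m, inferInstance, diag m hm, fun y => {y}, fun _ => rfl, fun y => by simp,
      fun x y h => ?_, by simpa using entropyBound_diag m hm⟩
    simp only [diag, ne_eq, ite_eq_right_iff, one_ne_zero, imp_false, not_not] at h
    simp [h]
  | succ L ih =>
    obtain ⟨Y, _, C, S, h1, h2, h3, h4⟩ := ih
    refine ⟨Y × Y, inferInstance, C.double, fun y => S y.1 ∪ S y.2, h1, fun y => ?_,
      fun x y h => ?_, by simpa using h4.double⟩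
    · refine (Finset.card_union_le _ _).trans ?_
      have := h2 y.1
      have := h2 y.2
      rw [pow_succ]; omega
    · rw [Finset.mem_union]
      by_contra hn
      rw [not_or] at hn
      apply h
      have e1 : C.down y.1 x = 0 := by_contra fun h' => hn.1 (h3 x y.1 h')
      have e2 : C.down y.2 x = 0 := by_contra fun h' => hn.2 (h3 x y.2 h')
      simp [double, e1, e2]

/-- The trivial coupling of two points. -/
def unit : Coupling Unit Unit where
  ρ _ := 1
  τ _ := 1
  down _ _ := 1
  up _ _ := 1
  ρ_nonneg _ := zero_le_one
  τ_nonneg _ := zero_le_one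
  down_nonneg _ _ := zero_le_one
  up_nonneg _ _ := zero_le_one
  sum_ρ := by simp
  sum_τ := by simp
  sum_down _ := by simp
  sum_up _ := by simp
  rev _ _ := rfl

/-- A hard distribution for lopsided disjointness: the coupling `C` is supported on disjoint pairs
of sets (given by their indicators), `κ` on pairs that meet in at most one point, and half of the
mass of `κ` is on intersecting pairs. -/
structure IsHard {ι X Y : Type} [Fintype ι] [Fintype X] [Fintype Y] (C : Coupling X Y)
    (κ : X → Y → ℝ) (p : X → ι → ℝ) (q : Y → ι → ℝ) (k : ℕ) (l : ℝ) : Prop where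
  p_zero_or_one : ∀ x i, p x i = 0 ∨ p x i = 1
  q_zero_or_one : ∀ y i, q y i = 0 ∨ q y i = 1
  sum_p : ∀ x, ∑ i, p x i = k
  disjoint : ∀ x y, C.joint x y ≠ 0 → ∑ i, p x i * q y i = 0
  κ_nonneg : ∀ x y, 0 ≤ κ x y
  inter : ∀ x y, κ x y ≠ 0 → ∑ i, p x i * q y i = 0 ∨ ∑ i, p x i * q y i = 1
  sum_κ : ∑ x, ∑ y, κ x y = l
  half_le : l / 2 ≤ ∑ x, ∑ y, κ x y * ∑ i, p x i * q y i
  entropyBound : C.EntropyBound l κ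

theorem sum_joint_eq_one {X Y : Type*} [Fintype X] [Fintype Y] (C : Coupling X Y) :
    ∑ x, ∑ y, C.joint x y = 1 := by
  simp [joint, ← Finset.mul_sum, C.sum_up, C.sum_ρ]

/-- The second set is the complement of the sampled `S y`. Coupled pairs have x in `S y`, hence are
disjoint; an independent x misses `S y` with probability at least 1/2, since `S y` has at most 2^L =
m/2 elements. -/
theorem exists_isHard_one (L m : ℕ) (hm : m = 2 ^ (L + 1)) :
    ∃ (Y : Type) (_ : Fintype Y) (C : Coupling (Fin m) Y) (κ : Fin m → Y → ℝ)
      (p : Fin m → Fin m → ℝ) (q : Y → Fin m → ℝ), IsHard C κ p q 1 L := by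
  have hm0 : 0 < m := by rw [hm]; positivity
  obtain ⟨Y, _, C, S, h1, h2, h3, h4⟩ := exists_sampling m L hm0
  have hpq : ∀ (x : Fin m) (y : Y), ∑ i, (if i = x then (1 : ℝ) else 0) *
      (if i ∈ S y then 0 else 1) = if x ∈ S y then 0 else 1 := fun x y => by
    rw [Finset.sum_eq_single x (fun i _ hi => by simp [hi]) (by simp)]
    simp
  refine ⟨Y, inferInstance, C, fun x y => L * (C.ρ x * C.τ y), fun x i => if i = x then 1 else 0,
    fun y i => if i ∈ S y then 0 else 1, ?_⟩
  refine ⟨fun x i => by split_ifs <;> simp, fun y i => by split_ifs <;> simp, fun x => by simp,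
    fun x y h => ?_, fun x y => ?_, fun x y _ => ?_, ?_, ?_, h4⟩
  · rw [hpq, if_pos]
    refine h3 x y fun h' => h ?_
    rw [joint_eq, h', mul_zero]
  · exact mul_nonneg (Nat.cast_nonneg _) (mul_nonneg (C.ρ_nonneg x) (C.τ_nonneg y))
  · rw [hpq]; split_ifs <;> simp
  · simp [← Finset.mul_sum, C.sum_τ, C.sum_ρ]
  · simp only [hpq]
    have hy : ∀ y, (1 / 2 : ℝ) ≤ ∑ x, C.ρ x * (if x ∈ S y then 0 else 1) := fun y => by
      have hc : ∑ x, (if x ∈ S y then (0 : ℝ) else 1) = m - (S y).card := by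
        have : ∀ x, (if x ∈ S y then (0 : ℝ) else 1) = 1 - if x ∈ S y then 1 else 0 := fun x => by
          split_ifs <;> simp
        simp only [this, Finset.sum_sub_distrib]
        simp
      simp only [h1, ← Finset.mul_sum, hc]
      have h5 : ((S y).card : ℝ) ≤ 2 ^ L := by exact_mod_cast h2 y
      have h6 : (m : ℝ) = 2 * 2 ^ L := by rw [hm, pow_succ]; push_cast; ring
      rw [h6, inv_mul_eq_div, le_div_iff₀ (by positivity)]
      linarith
    have : ∑ x, ∑ y, L * (C.ρ x * C.τ y) * (if x ∈ S y then (0 : ℝ) else 1) =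
        L * ∑ y, C.τ y * ∑ x, C.ρ x * (if x ∈ S y then 0 else 1) := by
      simp only [Finset.mul_sum]
      rw [Finset.sum_comm]
      exact Finset.sum_congr rfl fun _ _ => Finset.sum_congr rfl fun _ _ => by ring
    rw [this, div_eq_mul_one_div]
    refine mul_le_mul_of_nonneg_left ?_ (Nat.cast_nonneg _)
    calc (1 / 2 : ℝ) = ∑ y, C.τ y * (1 / 2) := by rw [← Finset.sum_mul, C.sum_τ, one_mul]
      _ ≤ _ := Finset.sum_le_sum fun y _ => mul_le_mul_of_nonneg_left (hy y) (C.τ_nonneg y)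

/-- Each summand of the new κ leaves one factor on its disjoint law, so only the other factor can
create an intersection; the masses add because joint laws have mass 1. -/
theorem IsHard.prod {ι X Y ι' X' Y' : Type} [Fintype ι] [Fintype X] [Fintype Y] [Fintype ι']
    [Fintype X'] [Fintype Y'] {C : Coupling X Y} {κ : X → Y → ℝ} {p : X → ι → ℝ} {q : Y → ι → ℝ}
    {k : ℕ} {l : ℝ} {C' : Coupling X' Y'} {κ' : X' → Y' → ℝ} {p' : X' → ι' → ℝ} {q' : Y' → ι' → ℝ}
    {k' : ℕ} {l' : ℝ} (h : IsHard C κ p q k l) (h' : IsHard C' κ' p' q' k' l') :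
    IsHard (C.prod C')
      (fun x y => κ x.1 y.1 * C'.joint x.2 y.2 + C.joint x.1 y.1 * κ' x.2 y.2)
      (fun x => Sum.elim (p x.1) (p' x.2)) (fun y => Sum.elim (q y.1) (q' y.2)) (k + k')
      (l + l') := by
  have prod_sum : ∀ (f : X → Y → ℝ) (g : X' → Y' → ℝ),
      ∑ x : X × X', ∑ y : Y × Y', f x.1 y.1 * g x.2 y.2 =
        (∑ x, ∑ y, f x y) * ∑ x, ∑ y, g x y := fun f g => by
    simp only [Fintype.sum_prod_type, Finset.sum_mul_sum]
  refine ⟨?_, ?_, ?_, ?_, ?_, ?_, ?_, ?_, h.entropyBound.prod h'.entropyBound⟩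
  · rintro x (i | i)
    exacts [h.p_zero_or_one _ _, h'.p_zero_or_one _ _]
  · rintro x (i | i)
    exacts [h.q_zero_or_one _ _, h'.q_zero_or_one _ _]
  · intro x
    simp [h.sum_p, h'.sum_p]
  · intro x y hj
    rw [prod_joint] at hj
    simp [h.disjoint _ _ (left_ne_zero_of_mul hj), h'.disjoint _ _ (right_ne_zero_of_mul hj)]
  · intro x y
    exact add_nonneg (mul_nonneg (h.κ_nonneg _ _) (C'.joint_nonneg _ _))
      (mul_nonneg (C.joint_nonneg _ _) (h'.κ_nonneg _ _))
  · intro x y hκ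
    simp only [Fintype.sum_sum_type, Sum.elim_inl, Sum.elim_inr]
    by_cases h1 : κ x.1 y.1 * C'.joint x.2 y.2 = 0
    · have h2 : C.joint x.1 y.1 * κ' x.2 y.2 ≠ 0 := fun h2 => hκ (by rw [h1, h2, add_zero])
      rw [h.disjoint _ _ (left_ne_zero_of_mul h2), zero_add]
      exact h'.inter _ _ (right_ne_zero_of_mul h2)
    · rw [h'.disjoint _ _ (right_ne_zero_of_mul h1), add_zero]
      exact h.inter _ _ (left_ne_zero_of_mul h1)
  · simp only [Finset.sum_add_distrib, prod_sum, h.sum_κ, h'.sum_κ, sum_joint_eq_one]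
    ring
  · have key : ∀ (x : X × X') (y : Y × Y'),
        (κ x.1 y.1 * C'.joint x.2 y.2 + C.joint x.1 y.1 * κ' x.2 y.2) *
          ∑ i, Sum.elim (p x.1) (p' x.2) i * Sum.elim (q y.1) (q' y.2) i =
        (κ x.1 y.1 * ∑ i, p x.1 i * q y.1 i) * C'.joint x.2 y.2 +
          C.joint x.1 y.1 * (κ' x.2 y.2 * ∑ i, p' x.2 i * q' y.2 i) := fun x y => by
      simp only [Fintype.sum_sum_type, Sum.elim_inl, Sum.elim_inr]
      have e1 : C.joint x.1 y.1 * ∑ i, p x.1 i * q y.1 i = 0 := by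
        by_cases hz : C.joint x.1 y.1 = 0
        · rw [hz, zero_mul]
        · rw [h.disjoint _ _ hz, mul_zero]
      have e2 : C'.joint x.2 y.2 * ∑ i, p' x.2 i * q' y.2 i = 0 := by
        by_cases hz : C'.joint x.2 y.2 = 0
        · rw [hz, zero_mul]
        · rw [h'.disjoint _ _ hz, mul_zero]
      linear_combination κ x.1 y.1 * e2 + κ' x.2 y.2 * e1
    simp only [key, Finset.sum_add_distrib]
    rw [prod_sum (fun x y => κ x y * ∑ i, p x i * q y i),
      prod_sum C.joint fun x y => κ' x y * ∑ i, p' x i * q' y i, sum_joint_eq_one,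
      sum_joint_eq_one]
    linarith [h.half_le, h'.half_le]

theorem exists_isHard (L m k : ℕ) (hm : m = 2 ^ (L + 1)) :
    ∃ (ι X Y : Type) (_ : Fintype ι) (_ : Fintype X) (_ : Fintype Y) (C : Coupling X Y)
      (κ : X → Y → ℝ) (p : X → ι → ℝ) (q : Y → ι → ℝ),
      Fintype.card ι = k * m ∧ IsHard C κ p q k (k * L) := by
  induction k with
  | zero =>
    refine ⟨Empty, Unit, Unit, inferInstance, inferInstance, inferInstance, unit, fun _ _ => 0,
      fun _ => Empty.elim, fun _ => Empty.elim, by simp, ?_⟩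
    refine ⟨fun _ i => i.elim, fun _ i => i.elim, by simp, by simp, by simp, by simp, by simp,
      by simp, fun a b _ _ => ?_⟩
    simp [upGain, downGain, unit, avgUp, avgDown]
  | succ k ih =>
    obtain ⟨ι, X, Y, _, _, _, C, κ, p, q, hc, h⟩ := ih
    obtain ⟨Y', _, C', κ', p', q', h'⟩ := exists_isHard_one L m hm
    refine ⟨ι ⊕ Fin m, X × Fin m, Y × Y', inferInstance, inferInstance, inferInstance, _, _, _, _,
      ?_, by have := h.prod h'; rwa [← add_one_mul, ← Nat.cast_add_one] at this⟩
    rw [Fintype.card_sum, hc, Fintype.card_fin, add_one_mul]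

/-- The lower bound on the number of terms of a nonnegative factorization of the shifted lopsided
disjointness matrix. -/
theorem IsHard.le_log_card {ι X Y : Type} [Fintype ι] [Fintype X] [Fintype Y] {C : Coupling X Y}
    {κ : X → Y → ℝ} {p : X → ι → ℝ} {q : Y → ι → ℝ} {k : ℕ} {l : ℝ} (h : IsHard C κ p q k l)
    {σ : ℝ} (hσ : 1 ≤ σ) (hk : 0 < k) {R : Type*} [Fintype R] (u : R → X → ℝ) (v : R → Y → ℝ)
    (hu : ∀ w x, 0 ≤ u w x) (hv : ∀ w y, 0 ≤ v w y)
    (huv : ∀ x y, ∑ w, u w x * v w y = σ - 1 + (1 - ∑ i, p x i * q y i) ^ 2) :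
    l ≤ 20 * (σ * Real.log (Fintype.card R * (σ + k ^ 2) / σ)) := by
  have hX : Nonempty X := by
    by_contra hX
    rw [not_nonempty_iff] at hX
    simpa using C.sum_ρ
  set N : ℝ := σ + k ^ 2 with hN
  have hN0 : 0 < N := by positivity
  have hk1 : (1 : ℝ) ≤ k := by exact_mod_cast hk
  have hle : ∀ w x y, u w x * v w y ≤ N := fun w x y => by
    refine (Finset.single_le_sum (f := fun w => u w x * v w y)
      (fun w _ => mul_nonneg (hu w x) (hv w y)) (Finset.mem_univ w)).trans ?_
    rw [huv]
    have h0 : 0 ≤ ∑ i, p x i * q y i := Finset.sum_nonneg fun i _ => by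
      rcases h.p_zero_or_one x i with e | e <;> rcases h.q_zero_or_one y i with e' | e' <;>
        simp [e, e']
    have h1 : ∑ i, p x i * q y i ≤ k := by
      rw [← h.sum_p x]
      refine Finset.sum_le_sum fun i _ => ?_
      rcases h.p_zero_or_one x i with e | e <;> rcases h.q_zero_or_one y i with e' | e' <;>
        simp [e, e']
    nlinarith
  -- normalization of the factors
  have hmax : ∀ w, ∃ x₀, ∀ x, u w x ≤ u w x₀ := fun w => Finite.exists_max (u w)
  choose x₀ hx₀ using hmax
  -- `v'` is at most 1 because a single term is bounded by its matrix entry, hence by `N`. A term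
  -- whose maximum is 0 vanishes identically, so division by 0 does no harm.
  set u' : R → X → ℝ := fun w x => u w x / u w (x₀ w)
  set v' : R → Y → ℝ := fun w y => u w (x₀ w) * v w y / N
  have huv' : ∀ w x y, u' w x * v' w y = u w x * v w y / N := fun w x y => by
    by_cases hz : u w (x₀ w) = 0
    · have : u w x = 0 := le_antisymm (hz ▸ hx₀ w x) (hu w x)
      simp [u', v', this]
    · simp only [u', v']; field_simp
  have hM : ∀ x y, ∑ w, u' w x * v' w y = (σ - 1 + (1 - ∑ i, p x i * q y i) ^ 2) / N :=
    fun x y => by simp only [huv', ← Finset.sum_div, huv]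
  have main := h.entropyBound.le_log_card u' v' (fun w x => div_nonneg (hu _ _) (hu _ _))
    (fun w x => div_le_one_of_le₀ (hx₀ w x) (hu _ _))
    (fun w y => div_nonneg (mul_nonneg (hu _ _) (hv _ _)) hN0.le)
    (fun w y => div_le_one_of_le₀ (hle w _ y) hN0.le) (s := σ / N) (by positivity)
    (fun x y hj => by rw [hM, h.disjoint x y hj]; ring)
  -- Where κ is nonzero the intersection t is 0 or 1, so (1 - t)² = 1 - t and the entry is σ - t.
  have hκ : ∑ x, ∑ y, κ x y * ∑ w, u' w x * v' w y ≤ (l * σ - l / 2) / N := by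
    have e : ∀ x y, κ x y * ∑ w, u' w x * v' w y =
        (κ x y * σ - κ x y * ∑ i, p x i * q y i) / N := fun x y => by
      rw [hM]
      by_cases hz : κ x y = 0
      · simp [hz]
      · rcases h.inter x y hz with e | e <;> rw [e] <;> ring
    simp only [e, ← Finset.sum_div, Finset.sum_sub_distrib, ← Finset.sum_mul, h.sum_κ]
    have := h.half_le
    gcongr
  have e1 : (Fintype.card R : ℝ) / (σ / N) = Fintype.card R * N / σ := by
    have : σ ≠ 0 := by positivity
    field_simp
  rw [e1] at main
  have h2 : l / 2 / N ≤ 10 * (σ / N * Real.log (Fintype.card R * N / σ)) := by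
    refine le_trans ?_ main
    rw [show l / 2 / N = l * (σ / N) - (l * σ - l / 2) / N by ring]
    linarith
  rw [div_le_iff₀ hN0] at h2
  have e2 : 10 * (σ / N * Real.log (Fintype.card R * N / σ)) * N =
      10 * (σ * Real.log (Fintype.card R * N / σ)) := by field_simp
  linarith

end Coupling

/-! ### Slack matrices and facets -/

section Facets

variable {E : Type*} [AddCommGroup E] [Module ℝ E]

/-- `f` spans an extreme ray of the cone of affine functions that are nonnegative on `V`. -/
def IsExtremal (V : Finset E) (f : E →ᵃ[ℝ] ℝ) : Prop :=
  (∀ v ∈ V, 0 ≤ f v) ∧ (∃ v ∈ V, f v ≠ 0) ∧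
    ∀ g : E →ᵃ[ℝ] ℝ, (∀ v ∈ V, f v = 0 → g v = 0) → ∃ c : ℝ, ∀ v ∈ V, g v = c * f v

/-- An affine function that is nonnegative on a finite set is there a nonnegative combination of
extremal ones. -/
theorem exists_eq_sum_of_extremal {V : Finset E} {R : Type*} [Fintype R] (s : R → E →ᵃ[ℝ] ℝ)
    (hs : ∀ f, IsExtremal V f → ∃ w, ∃ c : ℝ, 0 ≤ c ∧ ∀ v ∈ V, f v = c * s w v)
    (f : E →ᵃ[ℝ] ℝ) (hf : ∀ v ∈ V, 0 ≤ f v) :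
    ∃ μ : R → ℝ, (∀ w, 0 ≤ μ w) ∧ ∀ v ∈ V, f v = ∑ w, μ w * s w v := by
  classical
  induction h : (V.filter fun v => f v ≠ 0).card using Nat.strong_induction_on generalizing f with
  | _ N ih =>
  by_cases hz : ∃ v ∈ V, f v ≠ 0
  swap
  · push Not at hz
    exact ⟨0, fun _ => le_rfl, fun v hv => by simp [hz v hv]⟩
  by_cases hx : IsExtremal V f
  · obtain ⟨w, c, hc, hw⟩ := hs f hx
    refine ⟨Pi.single w c, fun w' => ?_, fun v hv => ?_⟩
    · by_cases e : w' = w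
      · subst e; simpa using hc
      · simp [e]
    · rw [hw v hv, Finset.sum_eq_single w (fun i _ hi => by simp [hi]) (by simp)]
      simp
  have hg : ∃ g : E →ᵃ[ℝ] ℝ, (∀ v ∈ V, f v = 0 → g v = 0) ∧ ∀ c : ℝ, ∃ v ∈ V, g v ≠ c * f v := by
    by_contra hcon
    refine hx ⟨hf, hz, fun g hg => ?_⟩
    by_contra hc
    push Not at hc
    exact hcon ⟨g, hg, hc⟩
  obtain ⟨g, hg0, hgc⟩ := hg
  obtain ⟨v₀, hv₀, hfv₀⟩ := hz
  have hW : (V.filter fun v => f v ≠ 0).Nonempty := ⟨v₀, Finset.mem_filter.2 ⟨hv₀, hfv₀⟩⟩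
  obtain ⟨v₁, hv₁, hmin⟩ := Finset.exists_min_image _ (fun v => g v / f v) hW
  obtain ⟨v₂, hv₂, hmax⟩ := Finset.exists_max_image _ (fun v => g v / f v) hW
  rw [Finset.mem_filter] at hv₁ hv₂
  -- With the extreme ratios, g - αf and βf - g are nonnegative on `V`, each has a zero that `f`
  -- lacks, and their sum is (β - α)f: induction on the support of `f` applies.
  set α := g v₁ / f v₁ with hα
  set β := g v₂ / f v₂ with hβ
  have hlo : ∀ v ∈ V, α * f v ≤ g v := fun v hv => by
    by_cases e : f v = 0
    · rw [e, hg0 v hv e, mul_zero]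
    · have := hmin v (Finset.mem_filter.2 ⟨hv, e⟩)
      rwa [le_div_iff₀ (lt_of_le_of_ne (hf v hv) (Ne.symm e))] at this
  have hhi : ∀ v ∈ V, g v ≤ β * f v := fun v hv => by
    by_cases e : f v = 0
    · rw [e, hg0 v hv e, mul_zero]
    · have := hmax v (Finset.mem_filter.2 ⟨hv, e⟩)
      rwa [div_le_iff₀ (lt_of_le_of_ne (hf v hv) (Ne.symm e))] at this
  have hαβ : α < β := by
    refine lt_of_le_of_ne (hmax v₁ (Finset.mem_filter.2 hv₁)) fun e => ?_
    obtain ⟨v, hv, hne⟩ := hgc α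
    exact hne (le_antisymm (e ▸ hhi v hv) (hlo v hv))
  have step : ∀ (k : E →ᵃ[ℝ] ℝ) (v' : E), v' ∈ V → f v' ≠ 0 → k v' = 0 → (∀ v ∈ V, 0 ≤ k v) →
      (∀ v ∈ V, f v = 0 → k v = 0) →
      ∃ μ : R → ℝ, (∀ w, 0 ≤ μ w) ∧ ∀ v ∈ V, k v = ∑ w, μ w * s w v := by
    intro k v' hv' hfv' hkv' hk hk0
    refine ih _ ?_ k hk rfl
    rw [← h]
    refine Finset.card_lt_card ((Finset.ssubset_iff_of_subset fun v hv => ?_).2 ⟨v', ?_, ?_⟩)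
    · rw [Finset.mem_filter] at hv ⊢
      exact ⟨hv.1, fun e => hv.2 (hk0 v hv.1 e)⟩
    · exact Finset.mem_filter.2 ⟨hv', hfv'⟩
    · simp [hkv']
  obtain ⟨μ₁, h₁, e₁⟩ := step (g - α • f) v₁ hv₁.1 hv₁.2
    (by simp [hα, div_mul_cancel₀ _ hv₁.2]) (fun v hv => by simpa using hlo v hv)
    (fun v hv e => by simp [e, hg0 v hv e])
  obtain ⟨μ₂, h₂, e₂⟩ := step (β • f - g) v₂ hv₂.1 hv₂.2
    (by simp [hβ, div_mul_cancel₀ _ hv₂.2]) (fun v hv => by simpa using hhi v hv)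
    (fun v hv e => by simp [e, hg0 v hv e])
  have hd : 0 < β - α := sub_pos.2 hαβ
  refine ⟨fun w => (μ₁ w + μ₂ w) / (β - α),
    fun w => div_nonneg (add_nonneg (h₁ w) (h₂ w)) hd.le, fun v hv => ?_⟩
  have e₁' := e₁ v hv
  have e₂' := e₂ v hv
  simp only [AffineMap.coe_sub, AffineMap.coe_smul, Pi.sub_apply, Pi.smul_apply, smul_eq_mul]
    at e₁' e₂'
  have : ∑ w, (μ₁ w + μ₂ w) / (β - α) * s w v =
      (∑ w, μ₁ w * s w v + ∑ w, μ₂ w * s w v) / (β - α) := by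
    rw [← Finset.sum_add_distrib, Finset.sum_div]
    exact Finset.sum_congr rfl fun _ _ => by ring
  rw [this, ← e₁', ← e₂', eq_div_iff hd.ne']
  ring

theorem AffineMap.nonneg_on_convexHull {V : Set E} (f : E →ᵃ[ℝ] ℝ) (hf : ∀ v ∈ V, 0 ≤ f v) {x : E}
    (hx : x ∈ convexHull ℝ V) : 0 ≤ f x := by
  have hc : Convex ℝ (f ⁻¹' Set.Ici 0) := (convex_Ici 0).affine_preimage f
  exact convexHull_min (fun v hv => hf v hv) hc hx

theorem AffineMap.eqOn_convexHull {V : Set E} (f g : E →ᵃ[ℝ] ℝ) (h : ∀ v ∈ V, f v = g v) {x : E}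
    (hx : x ∈ convexHull ℝ V) : f x = g x := by
  have h1 := (f - g).nonneg_on_convexHull (V := V) (fun v hv => by simp [h v hv]) hx
  have h2 := (g - f).nonneg_on_convexHull (V := V) (fun v hv => by simp [h v hv]) hx
  simp only [AffineMap.coe_sub, Pi.sub_apply, sub_nonneg] at h1 h2
  exact le_antisymm h2 h1

theorem AffineMap.sum_smul_apply {R : Type*} [Fintype R] (μ : R → ℝ) (s : R → E →ᵃ[ℝ] ℝ) (x : E) :
    (∑ w, μ w • s w) x = ∑ w, μ w * s w x := by
  classical
  have : ∀ t : Finset R, (∑ w ∈ t, μ w • s w) x = ∑ w ∈ t, μ w * s w x := fun t => by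
    induction t using Finset.induction_on with
    | empty => simp
    | insert a t ha ih =>
      rw [Finset.sum_insert ha, Finset.sum_insert ha, ← ih]
      simp
  exact this _

theorem finrank_inf_ker_add_one [FiniteDimensional ℝ E] (W : Submodule ℝ E) (l : E →ₗ[ℝ] ℝ) {z : E}
    (hz : z ∈ W) (hl : l z ≠ 0) :
    Module.finrank ℝ (W ⊓ LinearMap.ker l : Submodule ℝ E) + 1 = Module.finrank ℝ W := by
  have h : (l.domRestrict W : Module.Dual ℝ W) ≠ 0 := fun h => hl (by
    have := LinearMap.congr_fun h ⟨z, hz⟩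
    simpa using this)
  rw [← Module.Dual.finrank_ker_add_one_of_ne_zero h, ← Submodule.finrank_map_subtype_eq]
  have : W ⊓ LinearMap.ker l = Submodule.map W.subtype (LinearMap.ker (l.domRestrict W)) := by
    ext x
    simp [Submodule.mem_map, and_comm]
  rw [this]

/-- The zero set of an extremal function is a facet. -/
theorem IsExtremal.isFacet [TopologicalSpace E] [IsTopologicalAddGroup E] [ContinuousSMul ℝ E]
    [T2Space E] [FiniteDimensional ℝ E] {V : Finset E} {f : E →ᵃ[ℝ] ℝ} (hf : IsExtremal V f)
    (hV : (V : Set E).Nontrivial) :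
    IsFacet (convexHull ℝ (V : Set E)) {x ∈ convexHull ℝ (V : Set E) | f x = 0} := by
  obtain ⟨hpos, ⟨v₁, hv₁, hfv₁⟩, hext⟩ := hf
  set Q := convexHull ℝ (V : Set E) with hQ
  set F := {x ∈ Q | f x = 0} with hF
  have hVQ : ∀ v ∈ V, v ∈ Q := fun v hv => subset_convexHull ℝ _ hv
  have hposQ : ∀ x ∈ Q, 0 ≤ f x := fun x hx => f.nonneg_on_convexHull hpos hx
  -- Without a zero on `V`, every affine function would be a multiple of `f` there. The constant 1
  -- makes `f` constant, hence every functional is constant on `V`, which has two points.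
  obtain ⟨v₀, hv₀, hfv₀⟩ : ∃ v₀ ∈ V, f v₀ = 0 := by
    by_contra hcon
    push Not at hcon
    obtain ⟨v, hv, w, hw, hvw⟩ := hV
    refine hvw (sub_eq_zero.1 ((Module.forall_dual_apply_eq_zero_iff ℝ (v - w)).1 fun l => ?_))
    obtain ⟨c₁, h₁⟩ := hext (AffineMap.const ℝ E 1) fun u hu e => absurd e (hcon u hu)
    obtain ⟨c₂, h₂⟩ := hext l.toAffineMap fun u hu e => absurd e (hcon u hu)
    have e₁ := h₁ v hv
    have e₂ := h₁ w hw
    simp only [AffineMap.const_apply] at e₁ e₂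
    have hc₁ : c₁ ≠ 0 := fun e => by simp [e] at e₁
    have hfvw : f v = f w := mul_left_cancel₀ hc₁ (e₁.symm.trans e₂)
    have e₃ := h₂ v hv
    have e₄ := h₂ w hw
    simp only [LinearMap.coe_toAffineMap] at e₃ e₄
    rw [map_sub, e₃, e₄, hfvw, sub_self]
  have hv₀F : v₀ ∈ F := ⟨hVQ v₀ hv₀, hfv₀⟩
  refine ⟨⟨v₀, hv₀F⟩, fun _ => ?_, ?_⟩
  · refine ⟨-LinearMap.toContinuousLinearMap f.linear, ?_⟩
    have hle : ∀ x y, f.linear x ≤ f.linear y ↔ f x ≤ f y := fun x y => by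
      rw [f.decomp']; simp
    ext x
    simp only [hF, Set.mem_ofPred_eq, neg_apply,
      LinearMap.coe_toContinuousLinearMap', neg_le_neg_iff, hle]
    refine and_congr_right fun hx => ⟨fun h y hy => h ▸ hposQ y hy, fun h => ?_⟩
    exact le_antisymm (hfv₀ ▸ h v₀ (hVQ v₀ hv₀)) (hposQ x hx)
  · have hlin : ∀ x y, f.linear (x - y) = f x - f y := fun x y => by
      rw [← vsub_eq_sub, f.linearMap_vsub, vsub_eq_sub]
    have hspan : vectorSpan ℝ F = vectorSpan ℝ Q ⊓ LinearMap.ker f.linear := by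
      refine le_antisymm (le_inf (vectorSpan_mono ℝ fun x hx => hx.1) ?_) fun z hz => ?_
      · rw [vectorSpan, Submodule.span_le]
        rintro _ ⟨x, hx, y, hy, rfl⟩
        simp [hlin, hx.2, hy.2]
      -- A functional that kills the directions of `F` but not `z` is, after a shift, zero on `F`,
      -- hence a multiple of `f` on `Q`; then it kills `z`, as `f.linear` does.
      · by_contra hzF
        obtain ⟨h, hz0, hh⟩ := Submodule.exists_le_ker_of_notMem hzF
        obtain ⟨c, hc⟩ := hext (h.toAffineMap - AffineMap.const ℝ E (h v₀)) fun v hv hfv => by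
          have : h (v - v₀) = 0 := hh (vsub_mem_vectorSpan ℝ (show v ∈ F from ⟨hVQ v hv, hfv⟩) hv₀F)
          simpa using this
        have hcQ : ∀ x ∈ Q, h x - h v₀ = c * f x := fun x hx => by
          have := AffineMap.eqOn_convexHull (V := (V : Set E))
            (h.toAffineMap - AffineMap.const ℝ E (h v₀)) (c • f) (fun v hv => by simpa using hc v hv) hx
          simpa using this
        have hle : vectorSpan ℝ Q ≤ LinearMap.ker (h - c • f.linear) := by
          rw [vectorSpan, Submodule.span_le]
          rintro _ ⟨x, hx, y, hy, rfl⟩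
          have h1 := hcQ x hx
          have h2 := hcQ y hy
          simp only [vsub_eq_sub, SetLike.mem_coe, LinearMap.mem_ker, LinearMap.sub_apply,
            LinearMap.smul_apply, smul_eq_mul]
          rw [hlin, map_sub]
          linarith
        have h3 := hle hz.1
        have h4 : f.linear z = 0 := hz.2
        rw [LinearMap.mem_ker, LinearMap.sub_apply, LinearMap.smul_apply, h4] at h3
        exact hz0 (by simpa using h3)
    rw [hspan]
    refine finrank_inf_ker_add_one _ f.linear (z := v₁ - v₀)
      (vsub_mem_vectorSpan ℝ (hVQ v₁ hv₁) (hVQ v₀ hv₀)) ?_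
    rwa [hlin, hfv₀, sub_zero]

/-- Nonnegative factorization of slack matrices through the facets of a polytope. -/
theorem exists_facet_factorization [TopologicalSpace E] [IsTopologicalAddGroup E]
    [ContinuousSMul ℝ E] [T2Space E] [FiniteDimensional ℝ E] {Q : Set E} (hQ : IsPolytope Q)
    (hne : Q.Nontrivial) [Fintype {F : Set E | IsFacet Q F}] :
    ∃ s : {F : Set E | IsFacet Q F} → E →ᵃ[ℝ] ℝ, (∀ F, ∀ x ∈ Q, 0 ≤ s F x) ∧
      ∀ f : E →ᵃ[ℝ] ℝ, (∀ x ∈ Q, 0 ≤ f x) →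
        ∃ μ : {F : Set E | IsFacet Q F} → ℝ, (∀ F, 0 ≤ μ F) ∧
          ∀ x ∈ Q, f x = ∑ F, μ F * s F x := by
  classical
  obtain ⟨V', hV', hQV⟩ := hQ
  obtain ⟨V, rfl⟩ := hV'.exists_finset_coe
  have hV : (V : Set E).Nontrivial := by
    by_contra hcon
    rw [Set.not_nontrivial_iff] at hcon
    rcases hcon.eq_empty_or_singleton with e | ⟨x, e⟩
    · rw [hQV, e, convexHull_empty] at hne
      exact hne.nonempty.ne_empty rfl
    · rw [hQV, e, convexHull_singleton] at hne
      exact Set.not_nontrivial_singleton hne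
  have hVQ : ∀ v ∈ V, v ∈ Q := fun v hv => hQV ▸ subset_convexHull ℝ _ hv
  -- Extremal functions with equal zero sets are proportional on `V`, so one per facet is enough; a
  -- facet arising from none receives 0.
  have hs : ∀ F : {F : Set E | IsFacet Q F}, ∃ s : E →ᵃ[ℝ] ℝ, (∀ v ∈ V, 0 ≤ s v) ∧
      ((∃ f, IsExtremal V f ∧ (F : Set E) = {x ∈ Q | f x = 0}) →
        IsExtremal V s ∧ (F : Set E) = {x ∈ Q | s x = 0}) := fun F => by
    by_cases h : ∃ f, IsExtremal V f ∧ (F : Set E) = {x ∈ Q | f x = 0}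
    · obtain ⟨f, hf⟩ := h
      exact ⟨f, hf.1.1, fun _ => hf⟩
    · exact ⟨0, fun _ _ => le_rfl, fun h' => absurd h' h⟩
  choose s hs0 hs using hs
  refine ⟨s, fun F x hx => (s F).nonneg_on_convexHull (hs0 F) (hQV ▸ hx), fun f hf => ?_⟩
  have hgen : ∀ g, IsExtremal V g → ∃ F, ∃ c : ℝ, 0 ≤ c ∧ ∀ v ∈ V, g v = c * s F v := by
    intro g hg
    have hF := hg.isFacet hV
    rw [← hQV] at hF
    obtain ⟨hse, hsF⟩ := hs ⟨_, hF⟩ ⟨g, hg, rfl⟩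
    set t := s ⟨_, hF⟩ with ht
    obtain ⟨c, hc⟩ := hse.2.2 g fun v hv htv => by
      have : v ∈ {x ∈ Q | g x = 0} := by
        have h' : v ∈ {x ∈ Q | t x = 0} := ⟨hVQ v hv, htv⟩
        rwa [← hsF] at h'
      exact this.2
    refine ⟨⟨_, hF⟩, c, ?_, hc⟩
    obtain ⟨v, hv, htv⟩ := hse.2.1
    have h1 := hg.1 v hv
    rw [hc v hv] at h1
    exact nonneg_of_mul_nonneg_left h1 (lt_of_le_of_ne (hse.1 v hv) (Ne.symm htv))
  obtain ⟨μ, h0, hμ⟩ := exists_eq_sum_of_extremal s hgen f fun v hv => hf v (hVQ v hv)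
  refine ⟨μ, h0, fun x hx => ?_⟩
  rw [← AffineMap.sum_smul_apply]
  exact AffineMap.eqOn_convexHull f _ (V := (V : Set E))
    (fun v hv => by rw [AffineMap.sum_smul_apply, hμ v hv]) (hQV ▸ hx)

end Facets

/-- A lower bound on the nonnegative rank of slack matrices bounds the extension complexity. -/
theorem le_extensionComplexity {E : Type*} [AddCommGroup E] [Module ℝ E] {K : Set E}
    (hK : K.Nontrivial) {N : ℕ} {X Y : Type*} (pt : X → E) (hpt : ∀ x, pt x ∈ K)
    (f : Y → E →ᵃ[ℝ] ℝ) (hf : ∀ y, ∀ z ∈ K, 0 ≤ f y z)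
    (H : ∀ (R : Type) [Fintype R] (u : R → X → ℝ) (v : R → Y → ℝ), (∀ w x, 0 ≤ u w x) →
      (∀ w y, 0 ≤ v w y) → (∀ x y, ∑ w, u w x * v w y = f y (pt x)) → N ≤ Fintype.card R) :
    (N : ℕ∞) ≤ extensionComplexity K := by
  refine le_iInf fun d => le_iInf fun Q => le_iInf fun hQ => ?_
  obtain ⟨hpoly, π, hπ⟩ := hQ
  -- With infinitely many facets the bound is trivial, so finiteness need not be proved.
  by_cases hfin : {F : Set (Fin d → ℝ) | IsFacet Q F}.Finite
  swap
  · rw [numFacets, Set.Infinite.encard_eq hfin]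
    exact le_top
  have := hfin.fintype
  have hQne : Q.Nontrivial := by
    rw [← hπ] at hK
    exact Set.nontrivial_of_image _ _ hK
  obtain ⟨s, hs0, hs⟩ := exists_facet_factorization hpoly hQne
  have hpre : ∀ x, ∃ q ∈ Q, π q = pt x := fun x => by
    have := hpt x
    rwa [← hπ] at this
  choose q hq hqx using hpre
  have hfQ : ∀ y, ∀ z ∈ Q, 0 ≤ (f y).comp π.toAffineMap z := fun y z hz =>
    hf y _ (hπ ▸ Set.mem_image_of_mem π hz)
  choose μ hμ0 hμ using fun y => hs _ (hfQ y)
  have := H {F : Set (Fin d → ℝ) | IsFacet Q F} (fun F x => s F (q x)) (fun F y => μ y F)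
    (fun F x => hs0 F _ (hq x)) (fun F y => hμ0 y F) fun x y => by
      rw [← hqx x]
      have := hμ y (q x) (hq x)
      simp only [AffineMap.coe_comp, Function.comp_apply, LinearMap.coe_toAffineMap] at this
      rw [this]
      exact Finset.sum_congr rfl fun _ _ => mul_comm _ _
  rw [numFacets, Set.encard_eq_coe_toFinset_card, Set.toFinset_card]
  exact_mod_cast this

/-! ### Slack functions of the lopsided correlation polytope -/

/-- The linear functional `X ↦ ∑ c i j X i j`. -/
def entrySum {n : ℕ} (c : Fin n → Fin n → ℝ) : Matrix (Fin n) (Fin n) ℝ →ₗ[ℝ] ℝ where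
  toFun X := ∑ i, ∑ j, c i j * X i j
  map_add' X Y := by simp [mul_add, Finset.sum_add_distrib]
  map_smul' r X := by
    simp only [Matrix.smul_apply, smul_eq_mul, RingHom.id_apply, Finset.mul_sum]
    exact Finset.sum_congr rfl fun _ _ => Finset.sum_congr rfl fun _ _ => by ring

/-- The functional `X ↦ ∑ a i a j X i j - 2 ∑ a i X i i`. -/
noncomputable def disjFunctional {n : ℕ} (a : Fin n → ℝ) : Matrix (Fin n) (Fin n) ℝ →ₗ[ℝ] ℝ :=
  entrySum fun i j => a i * a j - if i = j then 2 * a i else 0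

/-- Since bᵢ² = bᵢ, the linear part of the square can be read off the diagonal of bbᵀ. -/
theorem disjFunctional_vecMulVec {n : ℕ} (a b : Fin n → ℝ) (hb : ∀ i, b i = 0 ∨ b i = 1) :
    disjFunctional a (Matrix.vecMulVec b b) = (1 - ∑ i, b i * a i) ^ 2 - 1 := by
  have hbb : ∀ i, b i * b i = b i := fun i => by rcases hb i with h | h <;> simp [h]
  have h1 : disjFunctional a (Matrix.vecMulVec b b) =
      (∑ i, b i * a i) * (∑ i, b i * a i) - 2 * ∑ i, b i * a i := by
    simp only [disjFunctional, entrySum, LinearMap.coe_mk, AddHom.coe_mk, Matrix.vecMulVec_apply,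
      sub_mul, Finset.sum_sub_distrib, ite_mul, zero_mul, Finset.sum_ite_eq, Finset.mem_univ,
      if_true, hbb]
    rw [Finset.sum_mul_sum, Finset.mul_sum]
    congr 1
    · exact Finset.sum_congr rfl fun _ _ => Finset.sum_congr rfl fun _ _ => by ring
    · exact Finset.sum_congr rfl fun _ _ => by ring
  rw [h1]; ring

theorem nonneg_on_lcorrPolytope {n k : ℕ} (f : Matrix (Fin n) (Fin n) ℝ →ᵃ[ℝ] ℝ)
    (hf : ∀ b : Fin n → ℝ, (∀ i, b i = 0 ∨ b i = 1) → 0 ≤ f (Matrix.vecMulVec b b))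
    {M : Matrix (Fin n) (Fin n) ℝ} (hM : M ∈ lcorrPolytope n k) : 0 ≤ f M := by
  refine f.nonneg_on_convexHull ?_ hM
  rintro _ ⟨b, hb, -, rfl⟩
  exact hf b hb

theorem apply_nonneg_of_mem_lcorrPolytope {n k : ℕ} {M : Matrix (Fin n) (Fin n) ℝ}
    (hM : M ∈ lcorrPolytope n k) (i j : Fin n) : 0 ≤ M i j := by
  refine nonneg_on_lcorrPolytope (Matrix.entryLinearMap ℝ ℝ i j).toAffineMap (fun b hb => ?_) hM
  simp only [LinearMap.coe_toAffineMap, Matrix.entryLinearMap_apply, Matrix.vecMulVec_apply]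
  rcases hb i with h | h <;> rcases hb j with h' | h' <;> simp [h, h']

theorem neg_one_le_disjFunctional {n k : ℕ} (a : Fin n → ℝ) {M : Matrix (Fin n) (Fin n) ℝ}
    (hM : M ∈ lcorrPolytope n k) : -1 ≤ disjFunctional a M := by
  have := nonneg_on_lcorrPolytope ((disjFunctional a).toAffineMap + AffineMap.const ℝ _ 1)
    (fun b hb => by
      simp only [AffineMap.coe_add, Pi.add_apply, LinearMap.coe_toAffineMap, AffineMap.const_apply,
        disjFunctional_vecMulVec a b hb]
      nlinarith [sq_nonneg (1 - ∑ i, b i * a i)]) hM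
  simp only [AffineMap.coe_add, Pi.add_apply, LinearMap.coe_toAffineMap, AffineMap.const_apply]
    at this
  linarith

theorem vecMulVec_mem_lcorrPolytope {n k : ℕ} {b : Fin n → ℝ} (hb : ∀ i, b i = 0 ∨ b i = 1)
    (hk : ∑ i, b i ≤ k) : Matrix.vecMulVec b b ∈ lcorrPolytope n k :=
  subset_convexHull ℝ _ ⟨b, hb, hk, rfl⟩

theorem single_mem_lcorrPolytope {n k : ℕ} (hk : 0 < k) (i : Fin n) :
    Matrix.vecMulVec (Pi.single i (1 : ℝ)) (Pi.single i (1 : ℝ)) ∈ lcorrPolytope n k := by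
  refine vecMulVec_mem_lcorrPolytope (fun j => ?_) ?_
  · by_cases h : j = i
    · subst h; simp
    · simp [h]
  · simpa using Nat.one_le_iff_ne_zero.2 hk.ne'

theorem nontrivial_of_lcorrPolytope_subset {n k : ℕ} (hk : 0 < k) (i : Fin n)
    {K : Set (Matrix (Fin n) (Fin n) ℝ)} (hK : lcorrPolytope n k ⊆ K) : K.Nontrivial := by
  refine ⟨_, hK (single_mem_lcorrPolytope hk i), Matrix.vecMulVec 0 0,
    hK (vecMulVec_mem_lcorrPolytope (fun _ => Or.inl rfl) (by simp)), fun h => ?_⟩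
  have := congrFun (congrFun h i) i
  simp [Matrix.vecMulVec_apply] at this

theorem pos_of_lcorrPolytope_subset_smul {n k : ℕ} (hk : 0 < k) (i : Fin n) {σ : ℝ}
    (h : lcorrPolytope n k ⊆ σ • lcorrPolytope n k) : 0 < σ := by
  obtain ⟨M, hM, hMσ⟩ := h (single_mem_lcorrPolytope hk i)
  have h1 : σ * M i i = 1 := by
    have := congrFun (congrFun hMσ i) i
    simpa [Matrix.vecMulVec_apply] using this
  have h2 := apply_nonneg_of_mem_lcorrPolytope hM i i
  by_contra hσ
  nlinarith

/-- An approximation of the polytope has at least as large extension complexity as its dimension. -/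
theorem natCast_le_extensionComplexity {n k : ℕ} (hk : 0 < k) (i₀ : Fin n) {σ : ℝ} (hσ : 0 < σ)
    {K : Set (Matrix (Fin n) (Fin n) ℝ)} (hK : lcorrPolytope n k ⊆ K)
    (hKσ : K ⊆ σ • lcorrPolytope n k) : (n : ℕ∞) ≤ extensionComplexity K := by
  -- Diagonal entries at the matrices eⱼeⱼᵀ form the identity matrix, whose rank n bounds the number
  -- of terms.
  refine le_extensionComplexity (nontrivial_of_lcorrPolytope_subset hk i₀ hK)
    (fun i : Fin n => Matrix.vecMulVec (Pi.single i (1 : ℝ)) (Pi.single i (1 : ℝ)))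
    (fun i => hK (single_mem_lcorrPolytope hk i))
    (fun i : Fin n => (Matrix.entryLinearMap ℝ ℝ i i).toAffineMap) (fun i M' hM' => ?_) ?_
  · obtain ⟨M, hM, rfl⟩ := hKσ hM'
    have := apply_nonneg_of_mem_lcorrPolytope hM i i
    simp only [LinearMap.coe_toAffineMap, Matrix.entryLinearMap_apply, Matrix.smul_apply,
      smul_eq_mul]
    positivity
  · intro R _ u v _ _ huv
    have h : (Matrix.of fun x w => u w x : Matrix (Fin n) R ℝ) * Matrix.of v = 1 := by
      ext x y
      rw [Matrix.mul_apply]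
      simp only [Matrix.of_apply]
      rw [huv x y]
      by_cases e : x = y
      · subst e; simp [Matrix.vecMulVec_apply]
      · simp [Matrix.vecMulVec_apply, e, Ne.symm e]
    have h1 := Matrix.rank_mul_le_left (Matrix.of fun x w => u w x : Matrix (Fin n) R ℝ)
      (Matrix.of v)
    rw [h, Matrix.rank_one, Fintype.card_fin] at h1
    exact h1.trans (Matrix.rank_le_card_width _)

open Coupling in
/-- Lower bound in terms of the number of levels `L` with `k` blocks of size `2 ^ (L + 1)`. -/
theorem le_extensionComplexity_of_lcorrPolytope {n k : ℕ} (hk : 0 < k) (i₀ : Fin n) {σ : ℝ}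
    (hσ : 1 ≤ σ) {K : Set (Matrix (Fin n) (Fin n) ℝ)} (hK : lcorrPolytope n k ⊆ K)
    (hKσ : K ⊆ σ • lcorrPolytope n k) {L : ℕ} (hL : k * 2 ^ (L + 1) ≤ n) {N : ℕ}
    (hN : ∀ r : ℕ, k * L ≤ 20 * (σ * Real.log (r * (σ + k ^ 2) / σ)) → N ≤ r) :
    (N : ℕ∞) ≤ extensionComplexity K := by
  obtain ⟨ι, X, Y, _, _, _, C, κ, p, q, hcard, h⟩ := exists_isHard L _ k rfl
  obtain ⟨g⟩ : Nonempty (ι ↪ Fin n) :=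
    Function.Embedding.nonempty_of_card_le (by rwa [hcard, Fintype.card_fin])
  have hext : ∀ (s : ι → ℝ), (∀ i, s i = 0 ∨ s i = 1) →
      ∀ i, Function.extend g s 0 i = 0 ∨ Function.extend g s 0 i = 1 := fun s hs i => by
    by_cases hi : ∃ j, g j = i
    · obtain ⟨j, rfl⟩ := hi
      rw [g.injective.extend_apply]; exact hs j
    · rw [Function.extend_apply' _ _ _ hi]; exact Or.inl rfl
  have hsum : ∀ s : ι → ℝ, ∑ i, Function.extend g s 0 i = ∑ i, s i := fun s =>
    (Fintype.sum_of_injective g g.injective _ _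
      (fun i hi => by rw [Function.extend_apply' _ _ _ hi]; simp)
      fun i => (g.injective.extend_apply _ _ _).symm).symm
  have hsum₂ : ∀ s t : ι → ℝ, ∑ i, Function.extend g s 0 i * Function.extend g t 0 i =
      ∑ i, s i * t i := fun s t =>
    (Fintype.sum_of_injective g g.injective _ _
      (fun i hi => by rw [Function.extend_apply' _ _ _ hi]; simp)
      fun i => by rw [g.injective.extend_apply, g.injective.extend_apply]).symm
  refine le_extensionComplexity (nontrivial_of_lcorrPolytope_subset hk i₀ hK)
    (fun x : X => Matrix.vecMulVec (Function.extend g (p x) 0) (Function.extend g (p x) 0))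
    (fun x => hK (vecMulVec_mem_lcorrPolytope (hext _ (h.p_zero_or_one x)) ?_))
    (fun y : Y => (disjFunctional (Function.extend g (q y) 0)).toAffineMap +
      AffineMap.const ℝ _ σ) (fun y M' hM' => ?_) ?_
  · rw [hsum, h.sum_p]
  · obtain ⟨M, hM, rfl⟩ := hKσ hM'
    -- The bound -1 on P becomes -σ on σP, which the added constant compensates.
    have := neg_one_le_disjFunctional (Function.extend g (q y) 0) hM
    simp only [AffineMap.coe_add, Pi.add_apply, LinearMap.coe_toAffineMap, AffineMap.const_apply,
      map_smul, smul_eq_mul]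
    nlinarith
  · intro R _ u v hu hv huv
    refine hN _ (h.le_log_card hσ hk u v hu hv fun x y => ?_)
    rw [huv]
    simp only [AffineMap.coe_add, Pi.add_apply, LinearMap.coe_toAffineMap, AffineMap.const_apply,
      disjFunctional_vecMulVec _ _ (hext _ (h.p_zero_or_one x)), hsum₂]
    ring

/-! ### Comparison with the binomial coefficient -/

/-- This is the estimate (en/t)^t, from n^t / t! and t^t / t! ≤ e^t. -/
theorem log_choose_le {n t : ℕ} (ht : 0 < t) (htn : t ≤ n) :
    Real.log (n.choose t) ≤ t * (Real.log (n / t) + 1) := by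
  have ht' : (0 : ℝ) < t := by exact_mod_cast ht
  have hn' : (0 : ℝ) < n := by exact_mod_cast ht.trans_le htn
  have h0 : (0 : ℝ) < n.choose t := by exact_mod_cast Nat.choose_pos htn
  have h1 : (n.choose t : ℝ) ≤ (n / t * Real.exp 1) ^ t := by
    refine (Nat.choose_le_pow_div t n).trans ?_
    have h2 := Real.pow_div_factorial_le_exp (t : ℝ) ht'.le t
    have h3 : Real.exp 1 ^ t = Real.exp t := by rw [← Real.exp_nat_mul, mul_one]
    rw [mul_pow, h3, div_pow]
    calc (n : ℝ) ^ t / t.factorial = (n : ℝ) ^ t / t ^ t * (t ^ t / t.factorial) := by field_simp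
      _ ≤ _ := by gcongr
  refine (Real.log_le_log h0 h1).trans (le_of_eq ?_)
  rw [Real.log_pow, Real.log_mul (by positivity) (by positivity), Real.log_exp]

/-- The arithmetic that compares the entropy bound to the binomial coefficient. -/
theorem choose_le_of_log_bound {n k t r L : ℕ} {σ Λ x : ℝ} (hk : 0 < k) (hσ : 1 ≤ σ)
    (hn : 0 < n) (hΛ : Λ = Real.logb 2 ((n : ℝ) / k)) (hΛσ : 1000 * σ ^ 8 ≤ Λ)
    (hx : x = 1 / 1000 * k / σ ^ 8) (hxt : x ≤ t) (htx : t ≤ 2 * x) (hL : Λ ≤ L + 2)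
    (hr : k * L ≤ 20 * (σ * Real.log (r * (σ + k ^ 2) / σ))) : n.choose t ≤ r := by
  have hk' : (1 : ℝ) ≤ k := by exact_mod_cast hk
  have hn' : (0 : ℝ) < n := by exact_mod_cast hn
  set s := σ ^ 8 with hs
  have hσs : σ ≤ s := le_self_pow₀ hσ (by norm_num)
  have hs1 : 1 ≤ s := hσ.trans hσs
  have hΛ1 : 1000 ≤ Λ := by linarith
  have hL1 : Λ / 2 ≤ L := by linarith
  have hx0 : 0 < x := by rw [hx]; positivity
  have ht : (0 : ℝ) < t := hx0.trans_le hxt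
  rcases lt_or_ge n t with hnt | hnt
  · rw [Nat.choose_eq_zero_of_lt hnt]; exact Nat.zero_le _
  have hr0 : 0 < r := by
    rcases Nat.eq_zero_or_pos r with h | h
    · rw [h] at hr
      simp only [Nat.cast_zero, zero_mul, zero_div, Real.log_zero, mul_zero] at hr
      nlinarith
    · exact h
  have hr' : (1 : ℝ) ≤ r := by exact_mod_cast hr0
  -- lower bound on `log r`
  have hlog : Real.log (r * (σ + k ^ 2) / σ) ≤ Real.log r + 2 * k := by
    -- The normalization of the factors costs at most 2k in the logarithm, which Λ ≥ 1000s absorbs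
    -- below.
    have h1 : (σ + (k : ℝ) ^ 2) / σ ≤ (1 + k) ^ 2 := by
      rw [div_le_iff₀ (by linarith)]
      nlinarith [mul_nonneg (sub_nonneg.2 hσ) (sq_nonneg (k : ℝ)),
        mul_nonneg (by linarith : (0 : ℝ) ≤ σ) (by linarith : (0 : ℝ) ≤ k)]
    have h2 : Real.log ((σ + (k : ℝ) ^ 2) / σ) ≤ 2 * k := by
      refine (Real.log_le_log (by positivity) h1).trans ?_
      rw [Real.log_pow]
      have := Real.log_le_sub_one_of_pos (show (0 : ℝ) < 1 + k by linarith)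
      push_cast
      linarith
    rw [mul_div_assoc, Real.log_mul (by positivity) (by positivity)]
    linarith
  have hlogr : 0 ≤ Real.log r := Real.log_nonneg hr'
  have hlow : k * Λ / (80 * s) ≤ Real.log r := by
    -- Of kΛ/2, the overhead 40sk takes at most kΛ/25; more than kΛ/4 is left for 20s log r.
    have h1 : k * L ≤ 20 * (s * (Real.log r + 2 * k)) := by
      refine hr.trans ?_
      have : σ * Real.log (r * (σ + k ^ 2) / σ) ≤ s * (Real.log r + 2 * k) := by
        refine (mul_le_mul_of_nonneg_left hlog (by linarith)).trans ?_
        exact mul_le_mul_of_nonneg_right hσs (by linarith)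
      linarith
    have h2 : k * (Λ / 2) ≤ k * (L : ℝ) := mul_le_mul_of_nonneg_left hL1 (by linarith)
    rw [div_le_iff₀ (by positivity)]
    have h3 : (k : ℝ) * (1000 * s) ≤ k * Λ := mul_le_mul_of_nonneg_left hΛσ (by linarith)
    have h4 : 0 ≤ s * Real.log r := mul_nonneg (by linarith) hlogr
    linarith
  -- upper bound on the logarithm of the binomial coefficient
  have hnt' : Real.log (n / t) + 1 ≤ 4 * Λ := by
    have h1 : (n : ℝ) / t ≤ n / k * s * 1000 := by
      rw [div_le_iff₀ ht]
      have : (n : ℝ) = n / k * s * 1000 * x := by rw [hx]; field_simp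
      calc (n : ℝ) = n / k * s * 1000 * x := this
        _ ≤ _ := by gcongr
    have h2 := Real.log_le_log (by positivity) h1
    rw [Real.log_mul (by positivity) (by norm_num), Real.log_mul (by positivity) (by positivity)]
      at h2
    have h3 : Real.log (n / k) ≤ Λ := by
      have h4 : Real.log (n / k) = Λ * Real.log 2 := by
        rw [hΛ, Real.logb, div_mul_cancel₀ _ (by positivity)]
      have h5 : Real.log 2 ≤ 1 := by linarith [Real.log_two_lt_d9]
      rw [h4]
      exact mul_le_of_le_one_right (by linarith) h5
    have h6 := Real.log_le_sub_one_of_pos (show 0 < s by linarith)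
    have h7 := Real.log_le_sub_one_of_pos (show (0 : ℝ) < 1000 by norm_num)
    linarith
  have hup : Real.log (n.choose t) ≤ k * Λ / (80 * s) := by
    refine (log_choose_le (by exact_mod_cast ht) hnt).trans ?_
    -- With α = 1/1000 the factor 8x becomes k/(125s), below the k/(80s) available.
    calc (t : ℝ) * (Real.log (n / t) + 1) ≤ t * (4 * Λ) :=
          mul_le_mul_of_nonneg_left hnt' ht.le
      _ ≤ 2 * x * (4 * Λ) := mul_le_mul_of_nonneg_right htx (by linarith)
      _ = k * Λ / (125 * s) := by rw [hx]; field_simp; norm_num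
      _ ≤ _ := by gcongr; norm_num
  have h0 : (0 : ℝ) < n.choose t := by exact_mod_cast Nat.choose_pos hnt
  have := (Real.log_le_log_iff h0 (by linarith)).1 (hup.trans hlow)
  exact_mod_cast this

theorem corollary1p4 :
    ∃ α : ℝ, 0 < α ∧ α < 1 ∧
      ∀ (n k : ℕ) (σ : ℝ), 0 < k → 1 ≤ σ ^ 8 →
        σ ^ 8 ≤ 1 / (3 * 1000 ^ 8) * Real.logb 2 ((n : ℝ) / (k : ℝ)) →
        ∀ K : Set (Matrix (Fin n) (Fin n) ℝ), IsPolytope K →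
          lcorrPolytope n k ⊆ K → K ⊆ σ • lcorrPolytope n k →
            ((n.choose ⌈α * k / σ ^ 8⌉₊ : ℕ) : ℕ∞) ≤ extensionComplexity K := by
  refine ⟨1 / 1000, by norm_num, by norm_num, fun n k σ hk h1 h2 K _ hPK hKP => ?_⟩
  have hk' : (0 : ℝ) < k := by exact_mod_cast hk
  set Λ := Real.logb 2 ((n : ℝ) / k) with hΛ
  have hΛσ : 1000 * σ ^ 8 ≤ Λ := by
    have h3 : 3 * 1000 ^ 8 * σ ^ 8 ≤ Λ := by
      have := mul_le_mul_of_nonneg_left h2 (by norm_num : (0 : ℝ) ≤ 3 * 1000 ^ 8)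
      rwa [← mul_assoc, mul_one_div_cancel (by norm_num), one_mul] at this
    have h4 : 1000 * σ ^ 8 ≤ 3 * 1000 ^ 8 * σ ^ 8 :=
      mul_le_mul_of_nonneg_right (by norm_num) (by linarith)
    linarith
  have hn : 0 < n := by
    rcases Nat.eq_zero_or_pos n with h | h
    · rw [hΛ, h] at hΛσ
      simp only [Nat.cast_zero, zero_div, Real.logb_zero] at hΛσ
      linarith
    · exact h
  have hn' : (0 : ℝ) < n := by exact_mod_cast hn
  -- The even power allows negative σ; the inclusion P ⊆ σP excludes it, as diagonal entries on P
  -- are nonnegative.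
  have hσ0 : 0 < σ := pos_of_lcorrPolytope_subset_smul hk ⟨0, hn⟩ (hPK.trans hKP)
  have hσ : 1 ≤ σ := by
    by_contra hlt
    exact absurd h1 (not_le.2 (pow_lt_one₀ hσ0.le (not_le.1 hlt) (by norm_num)))
  set x : ℝ := 1 / 1000 * k / σ ^ 8 with hx
  have hx0 : 0 < x := by positivity
  -- For x ≤ 1 the ceiling may exceed 2x, so the entropy comparison is not available and the rank
  -- bound takes over.
  rcases le_or_gt x 1 with hx1 | hx1
  · have : ⌈x⌉₊ = 1 := le_antisymm (Nat.ceil_le.2 (by simpa using hx1)) (Nat.ceil_pos.2 hx0)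
    rw [this, Nat.choose_one_right]
    exact natCast_le_extensionComplexity hk ⟨0, hn⟩ hσ0 hPK hKP
  have hfl : 2 ≤ ⌊Λ⌋₊ := Nat.le_floor (by push_cast; linarith)
  -- Blocks have size 2^(L+1), which must not exceed n/k = 2^Λ; hence the shift by one.
  obtain ⟨L, hL⟩ : ∃ L, ⌊Λ⌋₊ = L + 1 := ⟨⌊Λ⌋₊ - 1, by omega⟩
  have hLΛ : Λ ≤ L + 2 := by
    have := Nat.lt_floor_add_one Λ
    rw [hL] at this
    push_cast at this
    linarith
  have hblocks : k * 2 ^ (L + 1) ≤ n := by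
    have h3 : ((L + 1 : ℕ) : ℝ) ≤ Λ := hL ▸ Nat.floor_le (by linarith)
    rw [hΛ, Real.le_logb_iff_rpow_le (by norm_num) (by positivity), Real.rpow_natCast,
      le_div_iff₀ hk'] at h3
    rw [mul_comm]
    exact_mod_cast h3
  refine le_extensionComplexity_of_lcorrPolytope hk ⟨0, hn⟩ hσ hPK hKP hblocks fun r hr => ?_
  refine choose_le_of_log_bound hk hσ hn hΛ hΛσ hx (Nat.le_ceil x) ?_ hLΛ hr
  have := Nat.ceil_lt_add_one hx0.le
  linarith
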